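/- Let $K$ be a number field with algebraic closure $\overline K$, let $v$ be a finite place of $K$ lying above the rational prime $p$, with corresponding prime $\mathfrak p$ of $K$, and let $f\in K[z]$ be a polynomial of degree $d\ge 2$ with $p\mid d$. Write $f^n$ for the $n$-th iterate of $f$ (with $f^0(z)=z$). For $a\in K$ let $f^{-n}(a)$ be the set of solutions of $f^n(z)=a$ in $\overline K$, let $T_\infty(f,a)=\bigcup_{n\ge 0}f^{-n}(a)\subseteq\overline K$, let $K_n=K(f^{-n}(a))$ and let $K_\infty=\bigcup_{n\ge0} K_n=K(T_\infty(f,a))$. The postcritical set of $f$ (in $\overline K$, or in $\mathbb C_v$) is the set of all $f^n(\gamma)$ with $n\ge 0$ and $f'(\gamma)=0$. We say that $f$ has potential good reduction at $v$ if there is a polynomial $\mu\in\overline K[z]$ of degree $1$ such that $\mu\circ f\circ\mu^{-1}$ is monic and its coefficients are integral with respect to every extension of $v$ to $\overline K$. We say that $f$ is postcritically bounded at $v$ if its postcritical set is $w$-adically bounded for every extension $w$ of $v$ to $\overline K$, and postcritically finite if its postcritical set is finite. Let $\mathbb C_v$ be the completion of an algebraic closure of the completion $K_v$. We say that $a\in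 K$ avoids the postcritical set of $f$ if some open disk of positive radius centered at $a$ in $\mathbb C_v$ contains no point of the postcritical set. Finally, $K_\infty/K$ is infinitely wildly ramified above $\mathfrak p$ if for every sequence $\mathfrak p\subseteq\mathfrak P_0\subseteq\mathfrak P_1\subseteq\mathfrak P_2\subseteq\cdots$, where $\mathfrak P_n$ is a prime of $K_n$, the $p$-adic valuations $v_p(e(\mathfrak P_n|\mathfrak p))$ of the ramification indices tend to infinity as $n\to\infty$. Suppose that $f$ has potential good reduction at $v$. (1) If $f$ is postcritically bounded at $v$, then for every $a\in K$ such that $T_\infty(f,a)$ is infinite and $a$ avoids the postcritical set of $f$, the extension $K_\infty/K$ is infinitely wildly ramified above $\mathfrak p$. (2) In particular, if $f$ is postcritically finite, then for every $a\in K$ such that $T_\infty(f,a)$ is infinite, the extension $K_\infty/K$ is infinitely wildly ramified above $\mathfrak p$. -/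

import Mathlib

open NumberField IsDedekindDomain Polynomial Filter

namespace ArborealWild

/-! ### Dynamics of polynomials -/

section Dynamics

/-- The set of all `f^n(γ)` with `n ≥ 0` and `γ ∈ F` a critical point of `f`. It is used only over
algebraically closed fields `F`. -/
def postcriticalSet {F : Type*} [Field F] (f : F[X]) : Set F :=
  {x | ∃ (n : ℕ) (γ : F), f.derivative.eval γ = 0 ∧ (fun z => f.eval z)^[n] γ = x}

/-- The conjugate `μ ∘ f ∘ μ⁻¹` of `f` by the affine map `μ(z) = α z + β` (with `α ≠ 0`), whose
inverse is `μ⁻¹(z) = α⁻¹ (z - β)`. -/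
noncomputable def affineConj {F : Type*} [Field F] (α β : F) (f : F[X]) : F[X] :=
  ((C α * X + C β).comp f).comp (C α⁻¹ * (X - C β))

variable {K : Type*} [Field K]

/-- `f` is postcritically finite: the orbits of the critical points in the algebraic closure form
a finite set. -/
def PostcriticallyFinite (f : K[X]) : Prop :=
  (postcriticalSet (f.map (algebraMap K (AlgebraicClosure K)))).Finite

/-- `f^{-n}(a)`, the set of solutions of `f^n(z) = a` in the algebraic closure of `K`. -/
def preimages (f : K[X]) (a : K) (n : ℕ) : Set (AlgebraicClosure K) :=
  {x | (fun z => (f.map (algebraMap K (AlgebraicClosure K))).eval z)^[n] x =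
    algebraMap K (AlgebraicClosure K) a}

/-- `T_∞(f, a)`, the union of all `f^{-n}(a)`, `n ≥ 0`, as a subset of the algebraic closure. -/
def backwardOrbit (f : K[X]) (a : K) : Set (AlgebraicClosure K) :=
  ⋃ n : ℕ, preimages f a n

/-- `K_n = K(f^{-n}(a))`. -/
noncomputable def preimageField (f : K[X]) (a : K) (n : ℕ) :
    IntermediateField K (AlgebraicClosure K) :=
  IntermediateField.adjoin K (preimages f a n)

end Dynamics

variable {K : Type*} [Field K] [NumberField K]

/-! ### Reduction and boundedness at a finite place -/

/-- `f` is postcritically bounded at `v`: for every absolute value `w` on the algebraic closure of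
`K` extending the one of `v`, the critical orbits of `f` form a `w`-bounded set. -/
def PostcriticallyBounded (v : HeightOneSpectrum (𝓞 K)) (f : K[X]) : Prop :=
  ∀ w : AbsoluteValue (AlgebraicClosure K) ℝ, w.LiesOver (NumberField.HeightOneSpectrum.adicAbv K v) →
    ∃ B : ℝ, ∀ x ∈ postcriticalSet (f.map (algebraMap K (AlgebraicClosure K))), w x ≤ B

/-- `g` has good reduction at `w`: it is monic with `w`-integral coefficients. -/
def GoodReduction {F : Type*} [Field F] (w : AbsoluteValue F ℝ) (g : F[X]) : Prop :=
  g.Monic ∧ ∀ i, w (g.coeff i) ≤ 1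

/-- `f` has potential good reduction at `v`: some conjugate of `f` by a polynomial of degree `1`
over the algebraic closure of `K` has good reduction at every extension of `v`. -/
def PotentialGoodReduction (v : HeightOneSpectrum (𝓞 K)) (f : K[X]) : Prop :=
  ∃ α β : AlgebraicClosure K, α ≠ 0 ∧
    ∀ w : AbsoluteValue (AlgebraicClosure K) ℝ, w.LiesOver (NumberField.HeightOneSpectrum.adicAbv K v) →
      GoodReduction w (affineConj α β (f.map (algebraMap K (AlgebraicClosure K))))

/-! ### The field `ℂ_v` -/

noncomputable instance instNontriviallyNormedFieldCompletion (v : HeightOneSpectrum (𝓞 K)) :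
    NontriviallyNormedField (v.adicCompletion K) :=
  Valued.toNontriviallyNormedField (v.adicCompletion K) (WithZero (Multiplicative ℤ))

/-- An algebraic closure of the completion `K_v`. -/
abbrev LocalAlgClosure (v : HeightOneSpectrum (𝓞 K)) : Type _ :=
  AlgebraicClosure (v.adicCompletion K)

/-- The unique extension of the absolute value of `K_v` to its algebraic closure. -/
noncomputable instance instNormedFieldLocalAlgClosure (v : HeightOneSpectrum (𝓞 K)) :
    NormedField (LocalAlgClosure v) :=
  spectralNorm.normedField (v.adicCompletion K) (LocalAlgClosure v)

/-- `ℂ_v`, the completion of the algebraic closure of `K_v`. -/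
abbrev Cv (v : HeightOneSpectrum (𝓞 K)) : Type _ :=
  UniformSpace.Completion (LocalAlgClosure v)

/-- The embedding of `K` in `ℂ_v`. -/
noncomputable def toCv (v : HeightOneSpectrum (𝓞 K)) : K →+* Cv v :=
  (UniformSpace.Completion.coeRingHom : LocalAlgClosure v →+* Cv v).comp
    ((algebraMap (v.adicCompletion K) (LocalAlgClosure v)).comp
      (algebraMap K (v.adicCompletion K)))

/-- `a` avoids the postcritical set of `f` in `ℂ_v`: some open disk of positive radius in `ℂ_v`
around `a` contains no `f^n(γ)` with `n ≥ 0` and `γ ∈ ℂ_v` critical. -/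
def AvoidsPostcriticalSet (v : HeightOneSpectrum (𝓞 K)) (f : K[X]) (a : K) : Prop :=
  ∃ R : ℝ, 0 < R ∧ Disjoint (Metric.ball (toCv v a) R) (postcriticalSet (f.map (toCv v)))

/-! ### Infinite wild ramification -/

/-- A sequence `𝔓_0 ⊆ 𝔓_1 ⊆ ⋯` of primes `𝔓_n` of the fields `L_n`, all lying above the prime
of `v`. Inclusion is taken inside the algebraic closure of `K`. -/
structure IsPrimeTower (v : HeightOneSpectrum (𝓞 K))
    (L : ℕ → IntermediateField K (AlgebraicClosure K)) (P : ∀ n, Ideal (𝓞 (L n))) : Prop where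
  isPrime : ∀ n, (P n).IsPrime
  liesOver : ∀ n, (P n).LiesOver v.asIdeal
  nested : ∀ n (x : 𝓞 (L n)) (y : 𝓞 (L (n + 1))),
    ((x : L n) : AlgebraicClosure K) = ((y : L (n + 1)) : AlgebraicClosure K) →
      x ∈ P n → y ∈ P (n + 1)

/-- The tower `L_0 ⊆ L_1 ⊆ ⋯` over `K` is infinitely wildly ramified above the prime of `v`, which
lies above `p`: for any nested sequence of primes `𝔓_n` of `L_n` above that of `v`, the `p`-adic
valuation of the ramification index of `𝔓_n` over `K` tends to infinity. -/
def InfinitelyWildlyRamified (p : ℕ) (v : HeightOneSpectrum (𝓞 K))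
    (L : ℕ → IntermediateField K (AlgebraicClosure K)) : Prop :=
  ∀ P : ∀ n, Ideal (𝓞 (L n)), IsPrimeTower v L P →
    Tendsto (fun n => padicValNat p ((P n).ramificationIdx (𝓞 K))) atTop atTop

end ArborealWild

/-!
An affine conjugation moves the polynomial to a monic `g` of degree `d` whose coefficients are
integral for an absolute value `w` of the algebraic closure extending that of `v`. Bounded critical orbits force
the critical points into the closed unit disk, so `g'` is `d` times an integral polynomial and has
zero reduction (`isSmall_derivative`). Hence the reduction of `g` is a polynomial in `z ^ p`, and so
is every Taylor expansion of it: orders of vanishing on residue disks are divisible by `p`.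

Below, `a` is identified with its image in the new coordinate. On a residue disk around `x`, the
reduction of `g(x + z) - g(x)` as a polynomial in `z` vanishes to some order `m` at `0`, and `p ∣ m`.
If `‖t‖ < 1` is at least as large as the intermediate coefficients, then `g(x + z) = g(x) + t` has a
solution with `‖z‖ ^ m = ‖t‖` (`exists_solution`). Iterating
(`exists_chain`) gives points of the backward orbit of `a` whose distances to a reference point are
`m ^ n`-th roots of a fixed quantity `‖t‖ ≠ 0, 1`. The order `m` and the size of the intermediate
coefficients have to be uniform along the orbit, and there are two ways to achieve it.

* If some point of the backward orbit has a residue class that is not periodic, the classes along a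
  backward path above it are distinct, so all but finitely many of them have the generic order of
  vanishing. Some point of the path is not critical, has therefore a sibling in its residue disk, and
  two nearby backward paths are compared (`hasWildDistances_of_not_periodic`).
* Otherwise an iterate of `g` fixes the residue disk of `a` and has a fixed point `s` in it, which
  serves as reference point (`hasWildDistances_of_fixedPoint`). If the backward orbit of `a` contained
  no point of this disk other than `s`, it would be the cycle of `s`, hence finite.

If `a` lies outside the closed unit disk, its preimages have absolute values `‖a‖ ^ (1 / d ^ n)`, and
`0` is the reference point. All cases are summarised by `hasWildDistances_of_infinite`.

For the ramification index `e` of a prime of `K_n` above `v`, the group `w(K_n) ^ e` is contained in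
the powers of `w(π)`, with `π` a uniformizer of `v` (`exists_zpow_eq_of_mem`); as `K_n / K` is Galois,
the choice of the prime is immaterial. Adjoining the reference point and the coefficients of the
conjugation changes the value group by a bounded exponent only
(`exists_pow_factorial_eq_of_mem_sup`). A `Q`-th root of `‖t‖` with `p ^ N ∣ Q` in the value group
thus forces `p ^ N` to divide a fixed multiple of `e`.
-/

namespace ArborealWild

/-! ### Integral polynomials over an ultrametric field -/

section Ultrametric

variable {F : Type*} [NormedField F]

/-- The polynomials all of whose coefficients have norm less than `1`, that is, the polynomials
with zero reduction. -/
def IsSmall (h : F[X]) : Prop := ∀ i, ‖h.coeff i‖ < 1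

theorem IsSmall.C {x : F} (hx : ‖x‖ < 1) : IsSmall (C x) := fun i => by
  rw [coeff_C]
  split_ifs <;> simp [hx]

theorem monic_eq_prod_roots [IsAlgClosed F] {H : F[X]} (hm : H.Monic) :
    H = (H.roots.map fun r => X - Polynomial.C r).prod :=
  (IsAlgClosed.splits H).eq_prod_roots_of_monic hm

theorem norm_coeff_zero_eq_prod [IsAlgClosed F] {H : F[X]} (hm : H.Monic) :
    ‖H.coeff 0‖ = (H.roots.map fun r => ‖r‖).prod := by
  conv_lhs => rw [monic_eq_prod_roots hm]
  rw [coeff_zero_multiset_prod, Multiset.map_map]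
  induction H.roots using Multiset.induction_on with
  | empty => simp
  | cons a s ih =>
    rw [Multiset.map_cons, Multiset.prod_cons, norm_mul, ih, Multiset.map_cons, Multiset.prod_cons]
    simp

theorem exists_small_root [IsAlgClosed F] {H : F[X]} (hm : H.Monic) (h0 : ‖H.coeff 0‖ < 1) :
    ∃ w, H.eval w = 0 ∧ ‖w‖ < 1 := by
  by_contra! h
  rw [norm_coeff_zero_eq_prod hm] at h0
  refine absurd h0 (not_lt.2 ?_)
  refine Multiset.prod_induction (fun x : ℝ => 1 ≤ x) _
    (fun a b ha hb => one_le_mul_of_one_le_of_one_le ha hb) le_rfl fun x hx => ?_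
  obtain ⟨r, hr, rfl⟩ := Multiset.mem_map.1 hx
  exact h r (mem_roots'.1 hr).2

variable [IsUltrametricDist F]

theorem norm_sum_lt {ι : Type*} {s : Finset ι} {u : ι → F} {r : ℝ} (hr : 0 < r)
    (h : ∀ i ∈ s, ‖u i‖ < r) : ‖∑ i ∈ s, u i‖ < r := by
  classical
  induction s using Finset.induction_on with
  | empty => simpa using hr
  | insert a s ha ih =>
    rw [Finset.sum_insert ha]
    refine (IsUltrametricDist.norm_add_le_max _ _).trans_lt (max_lt (h _ (by simp)) (ih ?_))
    exact fun i hi => h i (by simp [hi])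

theorem norm_sum_le_of_forall_le {ι : Type*} {s : Finset ι} {u : ι → F} {r : ℝ} (hr : 0 ≤ r)
    (h : ∀ i ∈ s, ‖u i‖ ≤ r) : ‖∑ i ∈ s, u i‖ ≤ r :=
  IsUltrametricDist.norm_sum_le_of_forall_le_of_nonneg hr h

/-- In an ultrametric sum, a term strictly larger than all others determines the norm. -/
theorem norm_sum_eq_of_dominant {ι : Type*} [DecidableEq ι] {s : Finset ι} {u : ι → F} {a : ι}
    (ha : a ∈ s) (h0 : u a ≠ 0) (h : ∀ i ∈ s, i ≠ a → ‖u i‖ < ‖u a‖) :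
    ‖∑ i ∈ s, u i‖ = ‖u a‖ := by
  rw [← Finset.add_sum_erase s u ha]
  have : ‖∑ i ∈ s.erase a, u i‖ < ‖u a‖ :=
    norm_sum_lt (norm_pos_iff.2 h0) fun i hi => h i (Finset.mem_of_mem_erase hi)
      (Finset.ne_of_mem_erase hi)
  rw [IsUltrametricDist.norm_add_eq_max_of_norm_ne_norm this.ne', max_eq_left this.le]

variable (F) in
/-- The polynomials all of whose coefficients have norm at most `1`. -/
def integralPoly : Subring F[X] where
  carrier := {h | ∀ i, ‖h.coeff i‖ ≤ 1}
  mul_mem' {g h} hg hh i := by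
    rw [coeff_mul]
    refine norm_sum_le_of_forall_le zero_le_one fun x _ => ?_
    rw [norm_mul]
    exact mul_le_one₀ (hg _) (norm_nonneg _) (hh _)
  one_mem' i := by
    rw [coeff_one]
    split_ifs <;> simp
  add_mem' {g h} hg hh i := by
    rw [coeff_add]
    exact (IsUltrametricDist.norm_add_le_max _ _).trans (max_le (hg i) (hh i))
  zero_mem' i := by simp
  neg_mem' {g} hg i := by simpa using hg i

theorem X_mem_integralPoly : (X : F[X]) ∈ integralPoly F := fun i => by
  rw [coeff_X]
  split_ifs <;> simp

theorem C_mem_integralPoly {x : F} (hx : ‖x‖ ≤ 1) : C x ∈ integralPoly F := fun i => by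
  rw [coeff_C]
  split_ifs <;> simp [hx]

theorem IsSmall.mul {g h : F[X]} (hg : IsSmall g) (hh : h ∈ integralPoly F) :
    IsSmall (g * h) := fun i => by
  rw [coeff_mul]
  refine norm_sum_lt zero_lt_one fun x _ => ?_
  rw [norm_mul]
  exact mul_lt_one_of_nonneg_of_lt_one_left (norm_nonneg _) (hg _) (hh _)

theorem IsSmall.add {g h : F[X]} (hg : IsSmall g) (hh : IsSmall h) : IsSmall (g + h) := fun i => by
  rw [coeff_add]
  exact (IsUltrametricDist.norm_add_le_max _ _).trans_lt (max_lt (hg i) (hh i))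

theorem IsSmall.sum {ι : Type*} {s : Finset ι} {u : ι → F[X]} (h : ∀ i ∈ s, IsSmall (u i)) :
    IsSmall (∑ i ∈ s, u i) := fun i => by
  rw [finsetSum_coeff]
  exact norm_sum_lt zero_lt_one fun j hj => h j hj i

theorem comp_mem_integralPoly {g h : F[X]} (hg : g ∈ integralPoly F) (hh : h ∈ integralPoly F) :
    g.comp h ∈ integralPoly F := by
  rw [comp_eq_sum_left]
  exact Subring.sum_mem _ fun i _ =>
    Subring.mul_mem _ (C_mem_integralPoly (hg i)) (Subring.pow_mem _ hh _)

theorem IsSmall.comp {g h : F[X]} (hg : IsSmall g) (hh : h ∈ integralPoly F) :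
    IsSmall (g.comp h) := by
  rw [comp_eq_sum_left]
  exact IsSmall.sum fun i _ => (IsSmall.C (hg i)).mul (Subring.pow_mem _ hh _)

theorem taylor_mem_integralPoly {g : F[X]} (hg : g ∈ integralPoly F) {x : F} (hx : ‖x‖ ≤ 1) :
    taylor x g ∈ integralPoly F := by
  rw [taylor_apply]
  exact comp_mem_integralPoly hg
    (Subring.add_mem _ X_mem_integralPoly (C_mem_integralPoly hx))

theorem IsSmall.taylor {g : F[X]} (hg : IsSmall g) {x : F} (hx : ‖x‖ ≤ 1) :
    IsSmall (taylor x g) := by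
  rw [taylor_apply]
  exact hg.comp (Subring.add_mem _ X_mem_integralPoly (C_mem_integralPoly hx))

theorem eval_mem_unitBall {g : F[X]} (hg : g ∈ integralPoly F) {x : F} (hx : ‖x‖ ≤ 1) :
    ‖g.eval x‖ ≤ 1 := by
  rw [← taylor_coeff_zero]
  exact taylor_mem_integralPoly hg hx 0

theorem IsSmall.eval {g : F[X]} (hg : IsSmall g) {x : F} (hx : ‖x‖ ≤ 1) : ‖g.eval x‖ < 1 := by
  rw [← taylor_coeff_zero]
  exact hg.taylor hx 0

theorem norm_eval_sub_eval_le {g : F[X]} (hg : g ∈ integralPoly F) {x y : F} (hx : ‖x‖ ≤ 1)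
    (hy : ‖y‖ ≤ 1) : ‖g.eval x - g.eval y‖ ≤ ‖x - y‖ := by
  have hxy : ‖x - y‖ ≤ 1 := by
    rw [sub_eq_add_neg]
    exact (IsUltrametricDist.norm_add_le_max _ _).trans (max_le hx (by rwa [norm_neg]))
  have h := taylor_mem_integralPoly hg hy
  have e : g.eval x - g.eval y = (x - y) * (divX (taylor y g)).eval (x - y) := by
    have h1 := congrArg (Polynomial.eval (x - y)) (divX_mul_X_add (taylor y g))
    simp only [eval_add, eval_mul, eval_X, eval_C, taylor_coeff_zero, taylor_eval_sub] at h1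
    rw [← h1]
    ring
  rw [e, norm_mul]
  exact mul_le_of_le_one_right (norm_nonneg _)
    (eval_mem_unitBall (fun i => by rw [coeff_divX]; exact h _) hxy)

/-- Outside the closed unit disk the leading term dominates. -/
theorem norm_eval_eq_pow {g : F[X]} (hm : g.Monic) (hg : g ∈ integralPoly F) {x : F}
    (hx : 1 < ‖x‖) : ‖g.eval x‖ = ‖x‖ ^ g.natDegree := by
  have hx0 : x ≠ 0 := norm_pos_iff.1 (zero_lt_one.trans hx)
  rw [eval_eq_sum_range, norm_sum_eq_of_dominant (a := g.natDegree)]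
  · simp [hm]
  · simp
  · simp [hm, hx0]
  · intro i hi hne
    rw [Finset.mem_range] at hi
    simp only [norm_mul, norm_pow, hm.coeff_natDegree, one_mul]
    exact (mul_le_of_le_one_left (by positivity) (hg i)).trans_lt
      (pow_lt_pow_right₀ hx (by omega))

theorem norm_le_one_of_norm_eval_le_one {g : F[X]} (hm : g.Monic) (hg : g ∈ integralPoly F)
    (hd : g.natDegree ≠ 0) {x : F} (hx : ‖g.eval x‖ ≤ 1) : ‖x‖ ≤ 1 := by
  by_contra! h
  rw [norm_eval_eq_pow hm hg h] at hx
  exact absurd hx (not_le.2 (one_lt_pow₀ h hd))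

/-! ### Zeros of polynomials in open residue disks -/

/-- The reduction of `h` is integral and vanishes to order exactly `k` at the origin. -/
def HasReducedOrder (h : F[X]) (k : ℕ) : Prop :=
  h ∈ integralPoly F ∧ (∀ i < k, ‖h.coeff i‖ < 1) ∧ ‖h.coeff k‖ = 1

theorem HasReducedOrder.eq {h : F[X]} {k l : ℕ} (hk : HasReducedOrder h k)
    (hl : HasReducedOrder h l) : k = l := by
  rcases lt_trichotomy k l with hlt | heq | hlt
  · exact absurd hk.2.2 (hl.2.1 _ hlt).ne
  · exact heq
  · exact absurd hl.2.2 (hk.2.1 _ hlt).ne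

theorem HasReducedOrder.mul {g h : F[X]} {k l : ℕ} (hg : HasReducedOrder g k)
    (hh : HasReducedOrder h l) : HasReducedOrder (g * h) (k + l) := by
  refine ⟨Subring.mul_mem _ hg.1 hh.1, fun i hi => ?_, ?_⟩
  · rw [coeff_mul]
    refine norm_sum_lt zero_lt_one fun x hx => ?_
    rw [Finset.HasAntidiagonal.mem_antidiagonal] at hx
    rw [norm_mul]
    rcases lt_or_ge x.1 k with h1 | h1
    · exact mul_lt_one_of_nonneg_of_lt_one_left (norm_nonneg _) (hg.2.1 _ h1) (hh.1 _)
    · exact mul_lt_one_of_nonneg_of_lt_one_right (hg.1 _) (norm_nonneg _) (hh.2.1 _ (by omega))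
  · have h1 : ‖g.coeff k * h.coeff l‖ = 1 := by rw [norm_mul, hg.2.2, hh.2.2, one_mul]
    rw [coeff_mul, norm_sum_eq_of_dominant (a := (k, l)), h1]
    · simp
    · exact norm_pos_iff.1 (by rw [h1]; exact zero_lt_one)
    · intro x hx hne
      rw [Finset.HasAntidiagonal.mem_antidiagonal] at hx
      rw [h1, norm_mul]
      rcases lt_or_ge x.1 k with h2 | h2
      · exact mul_lt_one_of_nonneg_of_lt_one_left (norm_nonneg _) (hg.2.1 _ h2) (hh.1 _)
      · refine mul_lt_one_of_nonneg_of_lt_one_right (hg.1 _) (norm_nonneg _) (hh.2.1 _ ?_)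
        by_contra h3
        exact hne (Prod.ext (by simp only; omega) (by simp only; omega))

/-- A product of linear factors with integral roots reduces to a polynomial whose order at the
origin is the number of roots in the open unit disk. -/
theorem hasReducedOrder_prod (s : Multiset F) (hs : ∀ r ∈ s, ‖r‖ ≤ 1) :
    HasReducedOrder (s.map fun r => X - C r).prod (s.filter fun r => ‖r‖ < 1).card := by
  induction s using Multiset.induction_on with
  | empty => exact ⟨by simp, by simp, by simp⟩
  | cons r s ih =>
    have hr := hs r (by simp)
    have ih := ih fun r hr => hs r (by simp [hr])
    have hX : X - C r ∈ integralPoly F :=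
      Subring.sub_mem _ X_mem_integralPoly (C_mem_integralPoly hr)
    rw [Multiset.map_cons, Multiset.prod_cons]
    by_cases h : ‖r‖ < 1
    · rw [Multiset.filter_cons_of_pos (p := fun r : F => ‖r‖ < 1) _ h, Multiset.card_cons, add_comm]
      refine HasReducedOrder.mul ⟨hX, fun i hi => ?_, ?_⟩ ih
      · obtain rfl : i = 0 := by omega
        simpa using h
      · simp
    · rw [Multiset.filter_cons_of_neg (p := fun r : F => ‖r‖ < 1) _ h, ← zero_add (Multiset.card _)]
      refine HasReducedOrder.mul ⟨hX, by simp, ?_⟩ ih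
      simpa using le_antisymm hr (not_lt.1 h)

theorem norm_root_le_one {H : F[X]} (hm : H.Monic) (hH : H ∈ integralPoly F) {r : F}
    (hr : r ∈ H.roots) : ‖r‖ ≤ 1 := by
  have h0 : H.eval r = 0 := (mem_roots'.1 hr).2
  refine norm_le_one_of_norm_eval_le_one hm hH (fun hd => ?_) (by simp [h0])
  rw [eq_one_of_monic_natDegree_zero hm hd] at hr
  simp at hr

variable [IsAlgClosed F]

/-- If the reduction of a monic integral `H` vanishes at the origin to order `m`, then `H` has a
root `w` in the open unit disk with `‖H(0)‖ ≤ ‖w‖ ^ m`: the product of its `m` roots there has norm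
`‖H(0)‖`. -/
theorem exists_root_of_hasReducedOrder {H : F[X]} (hm : H.Monic) {m : ℕ}
    (hH : HasReducedOrder H m) (hpos : 0 < m) :
    ∃ w, H.eval w = 0 ∧ ‖w‖ < 1 ∧ ‖H.coeff 0‖ ≤ ‖w‖ ^ m := by
  have hle : ∀ r ∈ H.roots, ‖r‖ ≤ 1 := fun r hr => norm_root_le_one hm hH.1 hr
  set s := H.roots.filter fun r => ‖r‖ < 1 with hs
  have hcard : s.card = m := by
    have h1 := hasReducedOrder_prod H.roots hle
    rw [← monic_eq_prod_roots hm] at h1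
    exact h1.eq hH
  have hprod : ‖H.coeff 0‖ = (s.map fun r => ‖r‖).prod := by
    rw [norm_coeff_zero_eq_prod hm, ← Multiset.filter_add_not (fun r => ‖r‖ < 1) H.roots,
      Multiset.map_add, Multiset.prod_add, ← hs]
    rw [Multiset.prod_eq_one (s := Multiset.map _ (H.roots.filter fun r => ¬‖r‖ < 1)), mul_one]
    intro x hx
    obtain ⟨r, hr, rfl⟩ := Multiset.mem_map.1 hx
    rw [Multiset.mem_filter] at hr
    exact le_antisymm (hle r hr.1) (not_lt.1 hr.2)
  have hne : s ≠ 0 := by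
    rintro h
    rw [h] at hcard
    simp at hcard
    omega
  obtain ⟨w, hw, hmax⟩ : ∃ w ∈ s, ∀ r ∈ s, ‖r‖ ≤ ‖w‖ := by
    classical
    obtain ⟨a, ha⟩ := Multiset.exists_mem_of_ne_zero hne
    obtain ⟨w, hw, h⟩ := Multiset.toFinset s |>.exists_max_image (fun r => ‖r‖)
      ⟨a, Multiset.mem_toFinset.2 ha⟩
    exact ⟨w, Multiset.mem_toFinset.1 hw, fun r hr => h r (Multiset.mem_toFinset.2 hr)⟩
  have hw' := Multiset.mem_filter.1 hw
  refine ⟨w, (mem_roots'.1 hw'.1).2, hw'.2, ?_⟩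
  rw [hprod, ← hcard]
  calc (s.map fun r => ‖r‖).prod ≤ (s.map fun _ => ‖w‖).prod :=
        Multiset.prod_map_le_prod_map₀ _ _ (fun _ _ => norm_nonneg _) hmax
    _ = ‖w‖ ^ s.card := by simp

/-- Solving `G(w) = G(0) + t` in the open unit disk, when the reduction of `G - G(0)` vanishes to
order `m` at the origin. Once `‖t‖` exceeds the intermediate coefficients, the Newton polygon is a
single segment and `‖w‖ ^ m = ‖t‖`. -/
theorem exists_solution {G : F[X]} (hm : G.Monic) (hG : G ∈ integralPoly F) {m : ℕ} (hpos : 0 < m)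
    (hc : ∀ i, 0 < i → i < m → ‖G.coeff i‖ < 1)
    (hcm : ‖G.coeff m‖ = 1) {t : F} (ht : ‖t‖ < 1) :
    ∃ w, G.eval w = G.coeff 0 + t ∧ ‖w‖ < 1 ∧ ‖t‖ ≤ ‖w‖ ^ m ∧
      ((∀ i, 0 < i → i < m → ‖G.coeff i‖ ≤ ‖t‖) → ‖w‖ ^ m = ‖t‖) := by
  have hmle : m ≤ G.natDegree := le_natDegree_of_ne_zero fun h => by simp [h] at hcm
  have hdeg : 0 < G.natDegree := hpos.trans_le hmle
  set H := G - C (G.coeff 0 + t) with hHdef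
  have hHm : H.Monic := hm.sub_of_left (by
    rw [degree_eq_natDegree hm.ne_zero]
    exact degree_C_le.trans_lt (by exact_mod_cast hdeg))
  have hco : ∀ i, 0 < i → H.coeff i = G.coeff i := fun i hi => by
    simp [hHdef, coeff_C, hi.ne']
  have hH0 : H.coeff 0 = -t := by simp [hHdef]
  have hord : HasReducedOrder H m := by
    refine ⟨fun i => ?_, fun i hi => ?_, ?_⟩
    · rcases i.eq_zero_or_pos with rfl | hi
      · simpa [hH0] using ht.le
      · rw [hco i hi]; exact hG i
    · rcases i.eq_zero_or_pos with rfl | hi'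
      · simpa [hH0] using ht
      · rw [hco i hi']; exact hc i hi' hi
    · rw [hco m hpos, hcm]
  obtain ⟨w, hw0, hw1, hwt⟩ := exists_root_of_hasReducedOrder hHm hord hpos
  rw [hH0, norm_neg] at hwt
  refine ⟨w, ?_, hw1, hwt, fun hsm => ?_⟩
  · rwa [hHdef, eval_sub, eval_C, sub_eq_zero] at hw0
  by_contra hne
  have hgt : ‖t‖ < ‖w‖ ^ m := lt_of_le_of_ne hwt (Ne.symm hne)
  have hwpos : 0 < ‖w‖ := by
    rcases (norm_nonneg w).eq_or_lt with h | h
    · rw [← h, zero_pow hpos.ne'] at hgt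
      exact absurd hgt (not_lt.2 (norm_nonneg _))
    · exact h
  have hdegH : H.natDegree = G.natDegree := natDegree_sub_C ..
  have hterm : ‖H.coeff m * w ^ m‖ = ‖w‖ ^ m := by
    rw [norm_mul, hco m hpos, hcm, one_mul, norm_pow]
  have : ‖H.eval w‖ = ‖H.coeff m * w ^ m‖ := by
    rw [eval_eq_sum_range]
    refine norm_sum_eq_of_dominant (u := fun i => H.coeff i * w ^ i) (by simp; omega) ?_ ?_
    · exact norm_pos_iff.1 (by rw [hterm]; positivity)
    · intro i _ hi
      rw [hterm, norm_mul, norm_pow]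
      rcases i.eq_zero_or_pos with rfl | hi0
      · simpa [hH0] using hgt
      rw [hco i hi0]
      rcases lt_or_gt_of_ne hi with h | h
      · exact (mul_le_of_le_one_right (norm_nonneg _)
          (pow_le_one₀ (norm_nonneg _) hw1.le)).trans_lt ((hsm i hi0 h).trans_lt hgt)
      · exact (mul_le_of_le_one_left (by positivity) (hG i)).trans_lt
          (pow_lt_pow_right_of_lt_one₀ hwpos hw1 h)
  rw [hw0, hterm, norm_zero] at this
  exact (pow_pos hwpos m).ne this

end Ultrametric

/-! ### Distances in backward orbits -/

section Clusters

variable {F : Type*} [NormedField F]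

theorem exists_uniform_bound {ι : Type*} (s : Finset ι) (u : ι → ℝ) (h : ∀ i ∈ s, u i < 1) :
    ∃ ρ : ℝ, 0 ≤ ρ ∧ ρ < 1 ∧ ∀ i ∈ s, u i ≤ ρ := by
  classical
  induction s using Finset.induction_on with
  | empty => exact ⟨0, le_rfl, zero_lt_one, by simp⟩
  | insert a s _ ih =>
    obtain ⟨ρ, h0, h1, hρ⟩ := ih fun i hi => h i (by simp [hi])
    refine ⟨max ρ (u a), le_max_of_le_left h0, max_lt h1 (h a (by simp)), fun i hi => ?_⟩
    rcases Finset.mem_insert.1 hi with rfl | hi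
    · exact le_max_right _ _
    · exact le_max_of_le_left (hρ i hi)

/-- The backward orbit of `a` under `g` contains arbitrarily deep points `x` whose distance to some
`y`, either of the same level or the fixed reference point `s`, is a `Q`-th root of a fixed quantity
`‖t‖ ≠ 0, 1`, with `Q` divisible by a large power of `p`. -/
def HasWildDistances (p : ℕ) (g : F[X]) (a : F) : Prop :=
  ∃ s t : F, t ≠ 0 ∧ ‖t‖ ≠ 1 ∧ ∀ n : ℕ, ∃ (L Q : ℕ) (x y : F),
    (fun z => g.eval z)^[L] x = a ∧ ((fun z => g.eval z)^[L] y = a ∨ y = s) ∧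
      p ^ n ∣ Q ∧ ‖x - y‖ ^ Q = ‖t‖

theorem HasWildDistances.of_iterate {p : ℕ} {g : F[X]} {a b : F} {l : ℕ}
    (h : HasWildDistances p g b) (hb : (fun z => g.eval z)^[l] b = a) :
    HasWildDistances p g a := by
  obtain ⟨s, t, ht0, ht1, h⟩ := h
  refine ⟨s, t, ht0, ht1, fun n => ?_⟩
  obtain ⟨L, Q, x, y, hx, hy, hQ, hxy⟩ := h n
  refine ⟨l + L, Q, x, y, by rw [Function.iterate_add_apply, hx, hb], hy.imp_left fun hy => ?_,
    hQ, hxy⟩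
  rw [Function.iterate_add_apply, hy, hb]

theorem HasWildDistances.of_comp_iterate {p k : ℕ} {g g' : F[X]} {a : F}
    (h : HasWildDistances p g' a) (hg : (fun z => g'.eval z) = (fun z => g.eval z)^[k]) :
    HasWildDistances p g a := by
  obtain ⟨s, t, ht0, ht1, h⟩ := h
  refine ⟨s, t, ht0, ht1, fun n => ?_⟩
  obtain ⟨L, Q, x, y, hx, hy, hQ, hxy⟩ := h n
  rw [hg, ← Function.iterate_mul] at hx hy
  exact ⟨k * L, Q, x, y, hx, hy, hQ, hxy⟩

theorem exists_eval_eq {k : Type*} [Field k] [IsAlgClosed k] {g : k[X]} (hd : g.natDegree ≠ 0)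
    (y : k) : ∃ x, g.eval x = y := by
  obtain ⟨x, hx⟩ := IsAlgClosed.exists_root (g - C y) (fun h => hd (by
    rw [← natDegree_sub_C (a := y)]
    exact natDegree_eq_zero_iff_degree_le_zero.2 h.le))
  exact ⟨x, by simpa [sub_eq_zero] using hx⟩

theorem exists_iterate_eval_eq {k : Type*} [Field k] [IsAlgClosed k] {g : k[X]}
    (hd : g.natDegree ≠ 0) (n : ℕ) (y : k) : ∃ x, (fun z => g.eval z)^[n] x = y :=
  (Function.Surjective.iterate (fun y => exists_eval_eq hd y) n) y

theorem norm_iterate_eval_eq_pow [IsUltrametricDist F] {g : F[X]} (hm : g.Monic)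
    (hg : g ∈ integralPoly F) (hd : g.natDegree ≠ 0) {x : F} (hx : 1 < ‖x‖) (n : ℕ) :
    ‖(fun z => g.eval z)^[n] x‖ = ‖x‖ ^ g.natDegree ^ n := by
  induction n with
  | zero => simp
  | succ n ih =>
    rw [Function.iterate_succ_apply', norm_eval_eq_pow hm hg, ih, pow_succ, pow_mul]
    rw [ih]
    exact one_lt_pow₀ hx (pow_ne_zero _ hd)

theorem norm_iterate_eval_le_one [IsUltrametricDist F] {g : F[X]}
    (hg : g ∈ integralPoly F) {x : F} (hx : ‖x‖ ≤ 1) (n : ℕ) :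
    ‖(fun z => g.eval z)^[n] x‖ ≤ 1 := by
  induction n with
  | zero => simpa
  | succ n ih =>
    rw [Function.iterate_succ_apply']
    exact eval_mem_unitBall hg ih

theorem norm_le_one_of_norm_iterate_le_one [IsUltrametricDist F] {g : F[X]} (hm : g.Monic)
    (hg : g ∈ integralPoly F) (hd : g.natDegree ≠ 0) {x : F} {n : ℕ}
    (hx : ‖(fun z => g.eval z)^[n] x‖ ≤ 1) : ‖x‖ ≤ 1 := by
  by_contra! h
  rw [norm_iterate_eval_eq_pow hm hg hd h] at hx
  exact absurd hx (not_le.2 (one_lt_pow₀ h (pow_ne_zero _ hd)))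

theorem norm_iterate_sub_le [IsUltrametricDist F] {g : F[X]}
    (hg : g ∈ integralPoly F) {x y : F} (hx : ‖x‖ ≤ 1) (hy : ‖y‖ ≤ 1) (n : ℕ) :
    ‖(fun z => g.eval z)^[n] x - (fun z => g.eval z)^[n] y‖ ≤ ‖x - y‖ := by
  induction n with
  | zero => simp
  | succ n ih =>
    rw [Function.iterate_succ_apply', Function.iterate_succ_apply']
    exact (norm_eval_sub_eval_le hg (norm_iterate_eval_le_one hg hx n)
      (norm_iterate_eval_le_one hg hy n)).trans ih

theorem monic_taylor {g : F[X]} (hm : g.Monic) (x : F) : (taylor x g).Monic := by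
  rw [taylor_apply]
  exact hm.comp_X_add_C x

variable [IsUltrametricDist F]

/-- If the derivative has zero reduction, the reduction is a polynomial in `z ^ p`, so its orders of
vanishing are divisible by `p`. -/
theorem dvd_of_norm_taylor_coeff_eq_one {p : ℕ} (hp : p.Prime) (hpF : ‖(p : F)‖ < 1) {h : F[X]}
    (hd : IsSmall (derivative h)) {x : F} (hx : ‖x‖ ≤ 1) {m : ℕ} (hm : 0 < m)
    (hc : ‖(taylor x h).coeff m‖ = 1) : p ∣ m := by
  have hder : derivative (taylor x h) = taylor x (derivative h) := by
    simp [taylor_apply, derivative_comp]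
  have hsm := hd.taylor hx (m - 1)
  rw [← hder, coeff_derivative, Nat.sub_add_cancel hm, norm_mul, hc, one_mul, ← Nat.cast_succ,
    Nat.succ_eq_add_one, Nat.sub_add_cancel hm] at hsm
  by_contra hdvd
  have hcop := (hp.coprime_iff_not_dvd.2 hdvd).isCoprime
  obtain ⟨u, v, huv⟩ := hcop
  have huv' : (u : F) * p + v * m = 1 := by exact_mod_cast congrArg (Int.cast (R := F)) huv
  have h1 : ‖(u : F) * p + v * m‖ < 1 := by
    refine (IsUltrametricDist.norm_add_le_max _ _).trans_lt (max_lt ?_ ?_) <;> rw [norm_mul]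
    · exact mul_lt_one_of_nonneg_of_lt_one_right (IsUltrametricDist.norm_intCast_le_one F u)
        (norm_nonneg _) hpF
    · exact mul_lt_one_of_nonneg_of_lt_one_right (IsUltrametricDist.norm_intCast_le_one F v)
        (norm_nonneg _) hsm
  rw [huv', norm_one] at h1
  exact lt_irrefl _ h1

theorem IsSmall.exists_eval_bound {h : F[X]} (hh : IsSmall h) :
    ∃ ρ : ℝ, 0 ≤ ρ ∧ ρ < 1 ∧ ∀ x : F, ‖x‖ ≤ 1 → ‖h.eval x‖ ≤ ρ := by
  obtain ⟨ρ, h0, h1, hρ⟩ := exists_uniform_bound (Finset.range (h.natDegree + 1))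
    (fun i => ‖h.coeff i‖) fun i _ => hh i
  refine ⟨ρ, h0, h1, fun x hx => ?_⟩
  rw [eval_eq_sum_range]
  refine norm_sum_le_of_forall_le h0 fun i hi => ?_
  rw [norm_mul, norm_pow]
  exact (mul_le_of_le_one_right (norm_nonneg _) (pow_le_one₀ (norm_nonneg _) hx)).trans (hρ i hi)

/-- A polynomial whose reduction has infinitely many zeros has zero reduction. -/
theorem isSmall_of_infinite {S : Set F} (hS : S.Infinite) (hS1 : ∀ x ∈ S, ‖x‖ ≤ 1)
    (hS2 : ∀ x ∈ S, ∀ y ∈ S, x ≠ y → 1 ≤ ‖x - y‖) (n : ℕ) {h : F[X]} (hn : h.natDegree ≤ n)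
    (hh : h ∈ integralPoly F) (hev : ∀ x ∈ S, ‖h.eval x‖ < 1) : IsSmall h := by
  induction n generalizing h S with
  | zero =>
    obtain ⟨x, hx⟩ := hS.nonempty
    rw [eq_C_of_natDegree_le_zero hn] at hev ⊢
    exact IsSmall.C (by simpa using hev x hx)
  | succ n ih =>
    obtain ⟨x, hx⟩ := hS.nonempty
    set q := taylor (-x) (divX (taylor x h)) with hq
    have hx1 := hS1 x hx
    have hdec : h = q * (X - C x) + C (h.eval x) := by
      have h1 := congrArg (taylor (-x)) (divX_mul_X_add (taylor x h))
      rw [taylor_taylor, neg_add_cancel, taylor_zero, map_add, taylor_mul, taylor_X, taylor_C,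
        taylor_coeff_zero] at h1
      rw [hq, sub_eq_add_neg, ← C_neg, h1]
    have hqi : q ∈ integralPoly F := taylor_mem_integralPoly
      (fun i => by rw [coeff_divX]; exact taylor_mem_integralPoly hh hx1 _) (by rwa [norm_neg])
    have hqs : IsSmall q := by
      refine ih (S := S \ {x}) (hS.sdiff (Set.finite_singleton x)) (fun y hy => hS1 y hy.1)
        (fun y hy z hz => hS2 y hy.1 z hz.1) ?_ hqi fun y hy => ?_
      · rw [hq, natDegree_taylor, natDegree_divX_eq_natDegree_tsub_one, natDegree_taylor]
        omega
      · have h2 : q.eval y * (y - x) = h.eval y - h.eval x := by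
          conv_rhs => rw [hdec]
          simp
        have h3 : ‖q.eval y‖ * ‖y - x‖ < 1 := by
          rw [← norm_mul, h2, sub_eq_add_neg]
          refine (IsUltrametricDist.norm_add_le_max _ _).trans_lt (max_lt (hev y hy.1) ?_)
          rw [norm_neg]
          exact hev x hx
        exact (le_mul_of_one_le_right (norm_nonneg _) (hS2 y hy.1 x hx hy.2)).trans_lt h3
    rw [hdec]
    exact (hqs.mul (Subring.sub_mem _ X_mem_integralPoly (C_mem_integralPoly hx1))).add
      (IsSmall.C (hev x hx))

theorem iterate_comp_X_properties {g : F[X]} (hm : g.Monic) (hg : g ∈ integralPoly F)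
    (hd : g.natDegree ≠ 0) (hds : IsSmall (derivative g)) (k : ℕ) :
    (g.comp^[k] X).Monic ∧ g.comp^[k] X ∈ integralPoly F ∧
      (g.comp^[k] X).natDegree = g.natDegree ^ k ∧
        (0 < k → IsSmall (derivative (g.comp^[k] X))) := by
  induction k with
  | zero => exact ⟨monic_X, X_mem_integralPoly, by simp, by simp⟩
  | succ k ih =>
    obtain ⟨h1, h2, h3, h4⟩ := ih
    rw [Function.iterate_succ_apply']
    refine ⟨hm.comp h1 (by rw [h3]; exact pow_ne_zero _ hd), comp_mem_integralPoly hg h2,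
      by rw [natDegree_comp, h3, pow_succ'], fun _ => ?_⟩
    rw [derivative_comp, mul_comm]
    refine (hds.comp h2).mul fun i => ?_
    rw [coeff_derivative, norm_mul]
    exact mul_le_one₀ (h2 _) (norm_nonneg _)
      (by exact_mod_cast IsUltrametricDist.norm_natCast_le_one F (i + 1))

variable [IsAlgClosed F]

/-- Repeated application of `exists_solution`: starting from `0 < ‖t 0‖ < 1`, the norms of the
successive solutions increase until the intermediate coefficients no longer matter, and from then on
each norm is an `m`-th root of the preceding one. -/
theorem exists_chain {G : ℕ → F[X]} (hm : ∀ n, (G n).Monic) (hG : ∀ n, G n ∈ integralPoly F)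
    {m : ℕ} (hm2 : 2 ≤ m) {ρ : ℝ} (hρ0 : 0 ≤ ρ) (hρ : ρ < 1)
    (hc : ∀ n i, 0 < i → i < m → ‖(G n).coeff i‖ ≤ ρ) (hcm : ∀ n, ‖(G n).coeff m‖ = 1)
    {t₀ : F} (ht0 : t₀ ≠ 0) (ht1 : ‖t₀‖ < 1) :
    ∃ t : ℕ → F, t 0 = t₀ ∧ (∀ n, (G n).eval (t (n + 1)) = (G n).coeff 0 + t n) ∧
      (∀ n, t n ≠ 0 ∧ ‖t n‖ < 1) ∧ ∃ J, ∀ n, ‖t (J + n)‖ ^ m ^ n = ‖t J‖ := by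
  have hstep : ∀ (n : ℕ) (t : {t : F // t ≠ 0 ∧ ‖t‖ < 1}), ∃ w : {t : F // t ≠ 0 ∧ ‖t‖ < 1},
      (G n).eval w.1 = (G n).coeff 0 + t.1 ∧ ‖t.1‖ ≤ ‖w.1‖ ^ m ∧
        (ρ ≤ ‖t.1‖ → ‖w.1‖ ^ m = ‖t.1‖) := by
    rintro n ⟨t, h0, h1⟩
    obtain ⟨w, e, hw, hle, heq⟩ := exists_solution (hm n) (hG n) (by omega : 0 < m)
      (fun i hi hi' => (hc n i hi hi').trans_lt hρ) (hcm n) h1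
    refine ⟨⟨w, ?_, hw⟩, e, hle, fun hρt => heq fun i hi hi' => (hc n i hi hi').trans hρt⟩
    rintro rfl
    rw [norm_zero, zero_pow (by omega)] at hle
    exact h0 (norm_le_zero_iff.1 hle)
  choose w hw1 hw2 hw3 using hstep
  let t : ℕ → {t : F // t ≠ 0 ∧ ‖t‖ < 1} := fun n => Nat.rec ⟨t₀, ht0, ht1⟩ w n
  have hle : ∀ n, ‖(t n).1‖ ≤ ‖(t (n + 1)).1‖ ^ m := fun n => hw2 n (t n)
  refine ⟨fun n => (t n).1, rfl, fun n => hw1 n (t n), fun n => (t n).2, ?_⟩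
  have hmono : Monotone fun n => ‖(t n).1‖ := monotone_nat_of_le_succ fun n =>
    (hle n).trans (pow_le_of_le_one (norm_nonneg _) (t (n + 1)).2.2.le (by omega))
  obtain ⟨J, hJ⟩ : ∃ J, ρ ≤ ‖(t J).1‖ := by
    by_contra! hlt
    have hpow : ∀ n, ‖t₀‖ ≤ ‖(t n).1‖ ^ m ^ n := by
      intro n
      induction n with
      | zero => simp [t]
      | succ n ih =>
        refine ih.trans ?_
        rw [pow_succ', pow_mul]
        exact pow_le_pow_left₀ (norm_nonneg _) (hle n) _
    have hlim : Tendsto (fun n : ℕ => ρ ^ m ^ n) atTop (nhds 0) :=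
      (tendsto_pow_atTop_nhds_zero_of_lt_one hρ0 hρ).comp
        (tendsto_pow_atTop_atTop_of_one_lt (by omega : 1 < m))
    have := ge_of_tendsto' hlim fun n =>
      (hpow n).trans (pow_le_pow_left₀ (norm_nonneg _) (hlt n).le _)
    exact ht0 (norm_le_zero_iff.1 this)
  refine ⟨J, fun n => ?_⟩
  induction n with
  | zero => simp
  | succ n ih =>
    rw [pow_succ', pow_mul, ← add_assoc, hw3 (J + n) (t (J + n)), ih]
    exact hJ.trans (hmono (Nat.le_add_right J n))

/-- A point which is not critical has a sibling in its residue disk, because the linear coefficient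
of `g` at that point is small but nonzero. -/
theorem exists_sibling {g : F[X]} (hm : g.Monic) (hd : g.natDegree ≠ 0)
    (hds : IsSmall (derivative g)) {x : F} (hx : ‖x‖ ≤ 1) (hcrit : (derivative g).eval x ≠ 0) :
    ∃ r, r ≠ 0 ∧ ‖r‖ < 1 ∧ g.eval (x + r) = g.eval x := by
  set Q := divX (taylor x g) with hQ
  have hQ0 : Q.coeff 0 = (derivative g).eval x := by
    rw [hQ, coeff_divX, zero_add, taylor_coeff_one]
  have hQm : Q.Monic := by
    rw [Monic, leadingCoeff, hQ, natDegree_divX_eq_natDegree_tsub_one, coeff_divX,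
      Nat.sub_add_cancel (by rw [natDegree_taylor]; omega)]
    exact monic_taylor hm x
  obtain ⟨r, hr0, hr1⟩ := exists_small_root hQm (by rw [hQ0]; exact hds.eval hx)
  refine ⟨r, ?_, hr1, ?_⟩
  · rintro rfl
    rw [← coeff_zero_eq_eval_zero, hQ0] at hr0
    exact hcrit hr0
  · have h1 := congrArg (Polynomial.eval r) (divX_mul_X_add (taylor x g))
    rw [eval_add, eval_mul, ← hQ, hr0, zero_mul, zero_add, eval_C, taylor_coeff_zero,
      taylor_eval, add_comm r] at h1
    exact h1.symm

/-- Distances to a fixed point `s` along a backward orbit in its residue disk. -/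
theorem hasWildDistances_of_fixedPoint {p : ℕ} (hp : p.Prime) (hpF : ‖(p : F)‖ < 1) {g : F[X]}
    (hm : g.Monic) (hg : g ∈ integralPoly F) (hd : g.natDegree ≠ 0)
    (hds : IsSmall (derivative g)) {s x₀ : F} (hs : ‖s‖ ≤ 1) (hfix : g.eval s = s) (hne : x₀ ≠ s)
    (hnear : ‖x₀ - s‖ < 1) : HasWildDistances p g x₀ := by
  classical
  set G := taylor s g with hGdef
  have hGm : G.Monic := monic_taylor hm s
  have hGi : G ∈ integralPoly F := taylor_mem_integralPoly hg hs
  have hG0 : G.coeff 0 = s := by rw [hGdef, taylor_coeff_zero, hfix]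
  have hex : ∃ i, 0 < i ∧ ‖G.coeff i‖ = 1 := ⟨G.natDegree, by
    rw [hGdef, natDegree_taylor]; omega, by rw [hGm.coeff_natDegree, norm_one]⟩
  obtain ⟨hm0, hcm⟩ := Nat.find_spec hex
  have hmin : ∀ i, 0 < i → i < Nat.find hex → ‖G.coeff i‖ < 1 := fun i hi hi' =>
    lt_of_le_of_ne (hGi i) fun h => Nat.find_min hex hi' ⟨hi, h⟩
  set m := Nat.find hex
  have hpm : p ∣ m := dvd_of_norm_taylor_coeff_eq_one hp hpF hds hs hm0 hcm
  obtain ⟨ρ, hρ0, hρ1, hρ⟩ := exists_uniform_bound (Finset.Ioo 0 m) (fun i => ‖G.coeff i‖)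
    fun i hi => hmin i (Finset.mem_Ioo.1 hi).1 (Finset.mem_Ioo.1 hi).2
  obtain ⟨t, ht0, htG, htn, J, hJ⟩ := exists_chain (G := fun _ => G) (fun _ => hGm) (fun _ => hGi)
    (hp.two_le.trans (Nat.le_of_dvd hm0 hpm)) hρ0 hρ1
    (fun _ i hi hi' => hρ i (Finset.mem_Ioo.2 ⟨hi, hi'⟩)) (fun _ => hcm)
    (sub_ne_zero.2 hne) hnear
  have hit : ∀ n, (fun z => g.eval z)^[n] (s + t n) = x₀ := by
    intro n
    induction n with
    | zero => simp [ht0]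
    | succ n ih =>
      have := htG n
      rw [hG0, hGdef, taylor_eval, add_comm] at this
      rw [Function.iterate_succ_apply, this, ih]
  refine ⟨s, t J, (htn J).1, (htn J).2.ne, fun n => ⟨J + n, m ^ n, s + t (J + n), s, hit _,
    Or.inr rfl, pow_dvd_pow_of_dvd hpm n, ?_⟩⟩
  rw [add_sub_cancel_left, hJ]

/-- Distances between two backward orbits, when the residue class of `b` is not periodic: the
residue classes along a backward orbit of `b` are then distinct, so all but finitely many of them
have the generic order of vanishing. -/
theorem hasWildDistances_of_not_periodic {p : ℕ} (hp : p.Prime) (hpF : ‖(p : F)‖ < 1) {g : F[X]}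
    (hm : g.Monic) (hg : g ∈ integralPoly F) (hd : g.natDegree ≠ 0)
    (hd0 : derivative g ≠ 0) (hds : IsSmall (derivative g)) {b : F} (hb : ‖b‖ ≤ 1)
    (hper : ∀ k, 0 < k → 1 ≤ ‖(fun z => g.eval z)^[k] b - b‖) : HasWildDistances p g b := by
  classical
  choose ψ hψ using exists_eval_eq (g := g) hd
  let x : ℕ → F := fun n => ψ^[n] b
  have hx : ∀ n, g.eval (x (n + 1)) = x n := fun n => by
    simp only [x, Function.iterate_succ_apply', hψ]
  have hit : ∀ n k, (fun z => g.eval z)^[n] (x (n + k)) = x k := by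
    intro n k
    induction n with
    | zero => simp
    | succ n ih => rw [Function.iterate_succ_apply, Nat.add_right_comm, hx, ih]
  have hx1 : ∀ n, ‖x n‖ ≤ 1 := fun n =>
    norm_le_one_of_norm_iterate_le_one hm hg hd (n := n) (by
      have := hit n 0
      rw [add_zero] at this
      rw [this]
      exact hb)
  -- If `x (i + k)` and `x i` were close, so would be their images `x k` and `b` under `g^i`, and the
  -- images `b` and `g^k b` of these under `g^k`.
  have hlt : ∀ i k, 0 < k → 1 ≤ ‖x (i + k) - x i‖ := by
    intro i k hk
    by_contra! h
    have h1 := norm_iterate_sub_le hg (hx1 (i + k)) (hx1 i) i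
    rw [hit, show (fun z => g.eval z)^[i] (x i) = b from hit i 0] at h1
    have h2 := norm_iterate_sub_le hg (hx1 k) hb k
    rw [show (fun z => g.eval z)^[k] (x k) = b from hit k 0, norm_sub_rev] at h2
    exact absurd (hper k hk) (not_le.2 ((h2.trans h1).trans_lt h))
  have hdist : ∀ i j, i ≠ j → 1 ≤ ‖x i - x j‖ := by
    intro i j hij
    rcases lt_or_gt_of_ne hij with h | h
    · obtain ⟨k, rfl⟩ := Nat.exists_eq_add_of_lt h
      rw [norm_sub_rev]
      exact hlt i (k + 1) (by omega)
    · obtain ⟨k, rfl⟩ := Nat.exists_eq_add_of_lt h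
      exact hlt j (k + 1) (by omega)
  have hinj : Function.Injective x := fun i j h => by
    by_contra hij
    have := hdist i j hij
    rw [h, sub_self, norm_zero] at this
    exact absurd this (by norm_num)
  have hhasse : ∀ i, hasseDeriv i g ∈ integralPoly F := fun i j => by
    rw [hasseDeriv_coeff, norm_mul]
    exact mul_le_one₀ (IsUltrametricDist.norm_natCast_le_one F _) (norm_nonneg _) (hg _)
  have hex : ∃ i, 0 < i ∧ ¬IsSmall (hasseDeriv i g) := ⟨g.natDegree, Nat.pos_of_ne_zero hd,
    fun h => by simpa [hasseDeriv_coeff, hm] using h 0⟩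
  -- The generic order `m`: the first Hasse derivative with nonzero reduction.
  obtain ⟨hm0, hcm⟩ := Nat.find_spec hex
  have hmin : ∀ i, 0 < i → i < Nat.find hex → IsSmall (hasseDeriv i g) := fun i hi hi' =>
    not_not.1 fun h => Nat.find_min hex hi' ⟨hi, h⟩
  set m := Nat.find hex
  have hfin1 : {n | ‖(hasseDeriv m g).eval (x n)‖ < 1}.Finite := by
    by_contra h
    refine hcm (isSmall_of_infinite (S := x '' {n | ‖(hasseDeriv m g).eval (x n)‖ < 1})
      (Set.Infinite.image hinj.injOn h) ?_ ?_ _ le_rfl (hhasse m) ?_)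
    · rintro _ ⟨n, -, rfl⟩
      exact hx1 n
    · rintro _ ⟨n, -, rfl⟩ _ ⟨k, -, rfl⟩ hnk
      exact hdist n k fun h => hnk (by rw [h])
    · rintro _ ⟨n, hn, rfl⟩
      exact hn
  have hfin2 : {n | (derivative g).eval (x n) = 0}.Finite :=
    Set.Finite.preimage hinj.injOn ((derivative g).finite_setOfPred_isRoot hd0)
  -- Beyond `N` the path has generic order and avoids the critical points.
  obtain ⟨N, hN⟩ := (hfin1.union hfin2).bddAbove
  have hN1 : ∀ n, N < n → ‖(hasseDeriv m g).eval (x n)‖ = 1 := fun n hn =>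
    le_antisymm (eval_mem_unitBall (hhasse m) (hx1 n)) (not_lt.1 fun h =>
      absurd (hN (Or.inl h)) (not_le.2 hn))
  have hN2 : (derivative g).eval (x (N + 1)) ≠ 0 := fun h =>
    absurd (hN (Or.inr h)) (by omega)
  obtain ⟨r, hr0, hr1, hr⟩ := exists_sibling hm hd hds (hx1 _) hN2
  have hpm : p ∣ m := dvd_of_norm_taylor_coeff_eq_one hp hpF hds (hx1 (N + 1)) hm0
    (by rw [taylor_coeff]; exact hN1 _ (by omega))
  have hbound : ∃ ρ : ℝ, 0 ≤ ρ ∧ ρ < 1 ∧ ∀ i, 0 < i → i < m → ∀ z : F, ‖z‖ ≤ 1 →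
      ‖(hasseDeriv i g).eval z‖ ≤ ρ := by
    choose! u hu0 hu1 hu using fun i (hi : i ∈ Finset.Ioo 0 m) =>
      (hmin i (Finset.mem_Ioo.1 hi).1 (Finset.mem_Ioo.1 hi).2).exists_eval_bound
    obtain ⟨ρ, h0, h1, h⟩ := exists_uniform_bound _ u hu1
    exact ⟨ρ, h0, h1, fun i hi hi' z hz => (hu i (Finset.mem_Ioo.2 ⟨hi, hi'⟩) z hz).trans
      (h i (Finset.mem_Ioo.2 ⟨hi, hi'⟩))⟩
  obtain ⟨ρ, hρ0, hρ1, hρ⟩ := hbound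
  obtain ⟨t, ht0, htG, htn, J, hJ⟩ := exists_chain
    (G := fun n => taylor (x (N + 1 + (n + 1))) g)
    (fun n => monic_taylor hm _)
    (fun n => taylor_mem_integralPoly hg (hx1 _))
    (hp.two_le.trans (Nat.le_of_dvd hm0 hpm)) hρ0 hρ1
    (fun n i hi hi' => by rw [taylor_coeff]; exact hρ i hi hi' _ (hx1 _))
    (fun n => by rw [taylor_coeff]; exact hN1 _ (by omega)) hr0 hr1
  have hitt : ∀ n, (fun z => g.eval z)^[N + 1 + n] (x (N + 1 + n) + t n) = b := by
    intro n
    induction n with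
    | zero =>
      rw [add_zero, Function.iterate_succ_apply, ht0, hr, hx]
      exact hit N 0
    | succ n ih =>
      have := htG n
      rw [taylor_coeff_zero, taylor_eval, add_comm (t (n + 1)), ← add_assoc, hx] at this
      rw [← add_assoc, Function.iterate_succ_apply, this, ih]
  refine ⟨0, t J, (htn J).1, (htn J).2.ne, fun n => ⟨N + 1 + (J + n), m ^ n,
    x (N + 1 + (J + n)) + t (J + n), x (N + 1 + (J + n)), hitt _, Or.inl (hit _ 0),
    pow_dvd_pow_of_dvd hpm n, ?_⟩⟩
  rw [add_sub_cancel_left, hJ]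

/-- An infinite backward orbit of a monic integral polynomial whose derivative has zero reduction
exhibits distances of unbounded `p`-divisibility. -/
theorem hasWildDistances_of_infinite {p : ℕ} (hp : p.Prime) (hpF : ‖(p : F)‖ < 1) {g : F[X]}
    (hm : g.Monic) (hg : g ∈ integralPoly F) (hd : 2 ≤ g.natDegree) (hpd : p ∣ g.natDegree)
    (hd0 : derivative g ≠ 0) (hds : IsSmall (derivative g)) {a : F}
    (hinf : {x | ∃ n, (fun z => g.eval z)^[n] x = a}.Infinite) : HasWildDistances p g a := by
  have hd' : g.natDegree ≠ 0 := by omega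
  rcases lt_or_ge 1 ‖a‖ with ha | ha
  · -- Outside the closed unit disk, absolute values of preimages are `d`-th roots.
    refine ⟨0, a, norm_pos_iff.1 (zero_lt_one.trans ha), ha.ne', fun n => ?_⟩
    obtain ⟨x, hx⟩ := exists_iterate_eval_eq hd' n a
    refine ⟨n, g.natDegree ^ n, x, 0, hx, Or.inr rfl, pow_dvd_pow_of_dvd hpd n, ?_⟩
    have hx1 : 1 < ‖x‖ := by
      by_contra! h
      exact absurd (norm_iterate_eval_le_one hg h n) (by rw [hx]; exact not_le.2 ha)
    rw [sub_zero, ← norm_iterate_eval_eq_pow hm hg hd' hx1, hx]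
  have hunit : ∀ x n, (fun z => g.eval z)^[n] x = a → ‖x‖ ≤ 1 := fun x n hx =>
    norm_le_one_of_norm_iterate_le_one hm hg hd' (n := n) (by rw [hx]; exact ha)
  by_cases hN : ∃ b l, (fun z => g.eval z)^[l] b = a ∧
      ∀ k, 0 < k → 1 ≤ ‖(fun z => g.eval z)^[k] b - b‖
  · obtain ⟨b, l, hb, hper⟩ := hN
    exact (hasWildDistances_of_not_periodic hp hpF hm hg hd' hd0 hds (hunit b l hb) hper).of_iterate
      hb
  push Not at hN
  obtain ⟨k, hk, hak⟩ := hN a 0 rfl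
  obtain ⟨hm1, hg1, hdeg1, hds1⟩ := iterate_comp_X_properties hm hg hd' hds k
  set g₁ := g.comp^[k] X with hg₁
  have hds1 := hds1 hk
  have hev : (fun z => g₁.eval z) = (fun z => g.eval z)^[k] := by
    funext z
    rw [hg₁, iterate_comp_eval, eval_X]
  have hev' : ∀ z, g₁.eval z = (fun z => g.eval z)^[k] z := congrFun hev
  have hdeg1' : 2 ≤ g₁.natDegree := by
    rw [hdeg1]
    exact hd.trans (Nat.le_self_pow hk.ne' _)
  -- A fixed point `s` of `g₁` in the residue disk of `a`.
  obtain ⟨w, hw0, hw1⟩ := exists_small_root (H := taylor a (g₁ - X)) (by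
      have h1 : (g₁ - X).Monic := hm1.sub_of_left (by
        rw [degree_X, degree_eq_natDegree hm1.ne_zero]
        exact_mod_cast hdeg1')
      exact monic_taylor h1 a)
    (by rw [taylor_coeff_zero, eval_sub, eval_X, hev']; exact hak)
  rw [taylor_eval, eval_sub, eval_X, sub_eq_zero, add_comm] at hw0
  set s := a + w with hsdef
  have hs1 : ‖s‖ ≤ 1 := (IsUltrametricDist.norm_add_le_max _ _).trans (max_le ha hw1.le)
  have key : ∀ x l, (fun z => g.eval z)^[l] x = a → x ≠ s → ‖x - s‖ < 1 →
      HasWildDistances p g a := fun x l hx hne hlt =>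
    ((hasWildDistances_of_fixedPoint hp hpF hm1 hg1 (by omega) hds1 hs1 hw0 hne
      hlt).of_comp_iterate hev).of_iterate hx
  by_cases has : a = s
  swap
  · exact key a 0 rfl has (by rw [hsdef, norm_sub_rev, add_sub_cancel_left]; exact hw1)
  rw [← has] at hw0 hs1 key
  by_cases hx : ∃ x, g₁.eval x = a ∧ x ≠ a
  · obtain ⟨x, hx, hxa⟩ := hx
    have hxk : (fun z => g.eval z)^[k] x = a := by rw [← hev', hx]
    obtain ⟨j, hj, hxj⟩ := hN x k hxk
    have hx1 := hunit x k hxk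
    -- Both `x` and `a` are residually periodic with the same image, hence in the same disk.
    have hclose : ∀ i, ‖((fun z => g.eval z)^[j])^[i] x - x‖ < 1 := by
      intro i
      induction i with
      | zero => simp
      | succ i ih =>
        rw [Function.iterate_succ_apply]
        have h1 := norm_iterate_sub_le hg (norm_iterate_eval_le_one hg hx1 j) hx1 (j * i)
        rw [Function.iterate_mul] at h1
        calc _ = ‖(((fun z => g.eval z)^[j])^[i] ((fun z => g.eval z)^[j] x) -
              ((fun z => g.eval z)^[j])^[i] x) + (((fun z => g.eval z)^[j])^[i] x - x)‖ := by
              rw [sub_add_sub_cancel]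
          _ < 1 := (IsUltrametricDist.norm_add_le_max _ _).trans_lt
            (max_lt (h1.trans_lt hxj) ih)
    have hjk := hclose k
    rw [← Function.iterate_mul, mul_comm, Function.iterate_mul, ← hev] at hjk
    obtain ⟨j, rfl⟩ := Nat.exists_eq_succ_of_ne_zero hj.ne'
    rw [Function.iterate_succ_apply, hx, Function.iterate_fixed hw0, norm_sub_rev] at hjk
    exact key x k hxk hxa hjk
  · -- Otherwise the backward orbit of `a` is the cycle of `a`.
    push Not at hx
    refine absurd hinf (Set.not_infinite.2 ?_)
    refine Set.Finite.subset ((Set.finite_lt_nat k).image fun j => (fun z => g.eval z)^[j] a) ?_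
    rintro x ⟨n, hn⟩
    obtain ⟨y, hy⟩ := exists_iterate_eval_eq hd' (k * n - n) x
    have hle : n ≤ k * n := Nat.le_mul_of_pos_left n hk
    have hya : (fun z => g₁.eval z)^[n] y = a := by
      rw [hev, ← Function.iterate_mul, ← Nat.add_sub_of_le hle, Function.iterate_add_apply, hy, hn]
    have hyeq : y = a := by
      clear hy hn hle
      induction n with
      | zero => exact hya
      | succ n ih =>
        rw [Function.iterate_succ_apply'] at hya
        exact ih (hx _ hya)
    have hper : Function.IsPeriodicPt (fun z => g.eval z) k a := by
      rw [Function.IsPeriodicPt, Function.IsFixedPt, ← hev', hw0]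
    refine ⟨(k * n - n) % k, Nat.mod_lt _ hk, ?_⟩
    change (fun z => g.eval z)^[(k * n - n) % k] a = x
    rw [hper.iterate_mod_apply, ← hyeq, hy]

end Clusters

/-! ### Critical points and the derivative -/

section CriticalPoints

variable {F : Type*} [NormedField F] [IsUltrametricDist F] [IsAlgClosed F]

/-- For a monic integral polynomial with bounded critical orbits, all critical points lie in the
closed unit disk, so the derivative is its degree times a polynomial with integral coefficients. -/
theorem isSmall_derivative {g : F[X]} (hm : g.Monic) (hg : g ∈ integralPoly F)
    (hd : 2 ≤ g.natDegree) (hnd : ‖(g.natDegree : F)‖ < 1) [CharZero F]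
    (hB : ∃ B : ℝ, ∀ x ∈ postcriticalSet g, ‖x‖ ≤ B) : IsSmall (derivative g) := by
  obtain ⟨B, hB⟩ := hB
  have hroots : ∀ γ ∈ (derivative g).roots, ‖γ‖ ≤ 1 := by
    intro γ hγ
    by_contra! h
    have hlim : Tendsto (fun n : ℕ => ‖γ‖ ^ g.natDegree ^ n) atTop atTop :=
      (tendsto_pow_atTop_atTop_of_one_lt h).comp (tendsto_pow_atTop_atTop_of_one_lt hd)
    obtain ⟨n, hn⟩ := (hlim.eventually_gt_atTop B).exists
    rw [← norm_iterate_eval_eq_pow hm hg (by omega) h] at hn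
    exact absurd (hB _ ⟨n, γ, (mem_roots'.1 hγ).2, rfl⟩) (not_le.2 hn)
  rw [(IsAlgClosed.splits (derivative g)).eq_prod_roots]
  refine (IsSmall.C ?_).mul (hasReducedOrder_prod _ hroots).1
  rw [leadingCoeff, natDegree_derivative, coeff_derivative,
    Nat.sub_add_cancel (by omega), hm.coeff_natDegree, one_mul]
  rw [← Nat.cast_succ, Nat.succ_eq_add_one, Nat.sub_add_cancel (by omega)]
  exact hnd

end CriticalPoints

/-! ### Value groups in field extensions -/

section Extensions

variable {L : Type*} [Field L]

/-- Over a field `k`, an element `t` of degree at most `r` has `w(t) ^ r! = w(x)` for some `x ∈ k`: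
two terms of an equation for `t` have the same absolute value. -/
theorem exists_pow_factorial_eq {k : Type*} [Field k] [Algebra k L] (w : AbsoluteValue L ℝ)
    (hw : IsNonarchimedean w) {t : L} (ht : t ≠ 0) {r : ℕ} (hint : IsIntegral k t)
    (hr : (minpoly k t).natDegree ≤ r) :
    ∃ x : k, x ≠ 0 ∧ w t ^ r.factorial = w (algebraMap k L x) := by
  classical
  let : NormedField L := w.toNormedField
  have : IsUltrametricDist L := IsUltrametricDist.isUltrametricDist_of_isNonarchimedean_norm hw
  have hnorm : ∀ y : L, ‖y‖ = w y := fun _ => rfl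
  set q := minpoly k t
  set u : ℕ → L := fun i => algebraMap k L (q.coeff i) * t ^ i with hu
  have hsum : ∑ i ∈ Finset.range (q.natDegree + 1), u i = 0 := by
    rw [← minpoly.aeval k t, aeval_eq_sum_range]
    exact Finset.sum_congr rfl fun i _ => by rw [hu, Algebra.smul_def]
  obtain ⟨i, hi, hmax⟩ := (Finset.range (q.natDegree + 1)).exists_max_image (fun i => ‖u i‖)
    ⟨0, by simp⟩
  have hui : u i ≠ 0 := by
    intro h0
    have h1 := hmax q.natDegree (by simp)
    rw [h0, norm_zero, norm_le_zero_iff] at h1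
    simp [hu, (minpoly.monic hint).coeff_natDegree, q, ht] at h1
  obtain ⟨j, hj, hji, hle⟩ : ∃ j ∈ Finset.range (q.natDegree + 1), j ≠ i ∧ ‖u i‖ ≤ ‖u j‖ := by
    by_contra! h
    have := norm_sum_eq_of_dominant hi hui h
    rw [hsum, norm_zero] at this
    exact hui (norm_eq_zero.1 this.symm)
  have heq : ‖u j‖ = ‖u i‖ := le_antisymm (hmax j hj) hle
  have huj : u j ≠ 0 := norm_ne_zero_iff.1 (by rw [heq]; exact norm_ne_zero_iff.2 hui)
  -- It suffices to treat two exponents in increasing order.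
  have key : ∀ i j, i < j → j ≤ r → u i ≠ 0 → u j ≠ 0 → ‖u i‖ = ‖u j‖ →
      ∃ x : k, x ≠ 0 ∧ w t ^ r.factorial = w (algebraMap k L x) := by
    intro i j hij hjr hi0 hj0 h
    have hci : q.coeff i ≠ 0 := fun h => hi0 (by simp [hu, h])
    have hcj : q.coeff j ≠ 0 := fun h => hj0 (by simp [hu, h])
    have hpow : w t ^ (j - i) = w (algebraMap k L (q.coeff i / q.coeff j)) := by
      have hne : w (algebraMap k L (q.coeff j)) ≠ 0 := by simpa using hcj
      have hti : w t ^ i ≠ 0 := by simp [ht]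
      rw [map_div₀, map_div₀, eq_div_iff hne]
      refine mul_right_cancel₀ hti ?_
      simp only [hu, hnorm, map_mul, map_pow] at h
      rw [h]
      have hpa : w t ^ j = w t ^ (j - i) * w t ^ i := by
        rw [← pow_add, Nat.sub_add_cancel hij.le]
      rw [hpa]
      ring
    obtain ⟨c, hc⟩ := Nat.dvd_factorial (Nat.sub_pos_of_lt hij) ((Nat.sub_le j i).trans hjr)
    refine ⟨(q.coeff i / q.coeff j) ^ c, pow_ne_zero _ (div_ne_zero hci hcj), ?_⟩
    rw [hc, pow_mul, hpow, map_pow, map_pow]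
  rw [Finset.mem_range] at hi hj
  rcases lt_or_gt_of_ne hji with h | h
  · exact key j i h (by omega) huj hui heq
  · exact key i j h (by omega) hui huj heq.symm

variable {K : Type*} [Field K] [Algebra K L]

theorem isIntegral_and_natDegree_minpoly_le {E N : Type*} [Field E] [Field N] [Algebra K E]
    [Algebra K N] [Algebra E N] [IsScalarTower K E N] [FiniteDimensional K E]
    [FiniteDimensional K N] {r : ℕ}
    (h : Module.finrank K N ≤ Module.finrank K E * r) (t : N) :
    IsIntegral E t ∧ (minpoly E t).natDegree ≤ r := by
  have : FiniteDimensional E N := FiniteDimensional.right K E N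
  refine ⟨IsIntegral.of_finite E t, (minpoly.natDegree_le t).trans ?_⟩
  rw [← Module.finrank_mul_finrank K E N] at h
  exact Nat.le_of_mul_le_mul_left h Module.finrank_pos

theorem exists_pow_factorial_eq_of_mem_sup (w : AbsoluteValue L ℝ) (hw : IsNonarchimedean w)
    (E M : IntermediateField K L) [FiniteDimensional K E] [FiniteDimensional K M] {t : L}
    (ht : t ≠ 0) (htE : t ∈ E ⊔ M) :
    ∃ x : E, x ≠ 0 ∧ w t ^ (Module.finrank K M).factorial = w (x : L) := by
  have hle : E ≤ E ⊔ M := le_sup_left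
  let N := IntermediateField.extendScalars hle
  have : FiniteDimensional K N := inferInstanceAs (FiniteDimensional K ↥(E ⊔ M))
  obtain ⟨hint, hdeg⟩ := isIntegral_and_natDegree_minpoly_le (K := K) (E := E) (N := N)
    (IntermediateField.finrank_sup_le E M) ⟨t, htE⟩
  have hmin : minpoly E t = minpoly E (⟨t, htE⟩ : N) :=
    minpoly.algebraMap_eq (A := E) (B := N) (B' := L) (algebraMap N L).injective ⟨t, htE⟩
  obtain ⟨x, hx, h⟩ := exists_pow_factorial_eq (k := E) w hw ht
    (hint.map (IsScalarTower.toAlgHom E N L)) (hmin ▸ hdeg)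
  exact ⟨x, hx, h⟩

end Extensions

/-! ### Extensions of the absolute value and ramification indices -/

section Places

variable {K : Type*} [Field K] [NumberField K]

/-- The absolute value of `v` extends to the algebraic closure of `K`: embed it in the algebraic
closure of `K_v`. -/
theorem exists_absoluteValue_liesOver (v : HeightOneSpectrum (𝓞 K)) :
    ∃ w : AbsoluteValue (AlgebraicClosure K) ℝ,
      w.LiesOver (NumberField.HeightOneSpectrum.adicAbv K v) ∧ IsNonarchimedean w := by
  let σ : AlgebraicClosure K →ₐ[K] LocalAlgClosure v := IsAlgClosed.lift
  have hna : IsNonarchimedean (fun x : LocalAlgClosure v => ‖x‖) :=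
    isNonarchimedean_spectralNorm (K := v.adicCompletion K) (L := LocalAlgClosure v)
  let w : AbsoluteValue (AlgebraicClosure K) ℝ :=
    (NormedField.toAbsoluteValue (LocalAlgClosure v)).comp σ.toRingHom.injective
  have hw : ∀ x, w x = ‖σ x‖ := fun _ => rfl
  refine ⟨w, ⟨?_⟩, fun x y => ?_⟩
  · ext x
    change ‖σ (algebraMap K _ x)‖ = _
    rw [σ.commutes, IsScalarTower.algebraMap_apply K (v.adicCompletion K) (LocalAlgClosure v)]
    refine (spectralNorm_extends (K := v.adicCompletion K) (L := LocalAlgClosure v) _).trans ?_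
    exact FinitePlace.norm_embedding v x
  · rw [hw, hw, hw, map_add]
    exact hna _ _

variable {v : HeightOneSpectrum (𝓞 K)} {w : AbsoluteValue (AlgebraicClosure K) ℝ}

theorem apply_algebraMap_of_liesOver
    (hv : w.LiesOver (NumberField.HeightOneSpectrum.adicAbv K v)) (x : K) :
    w (algebraMap K (AlgebraicClosure K) x) = NumberField.HeightOneSpectrum.adicAbv K v x :=
  DFunLike.congr_fun hv.comp_eq x

theorem apply_le_one_of_isIntegral (hw : IsNonarchimedean w) {x : AlgebraicClosure K}
    (hx : IsIntegral ℤ x) : w x ≤ 1 := by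
  let : NormedField (AlgebraicClosure K) := w.toNormedField
  have : IsUltrametricDist (AlgebraicClosure K) :=
    IsUltrametricDist.isUltrametricDist_of_isNonarchimedean_norm hw
  obtain ⟨q, hq, hqx⟩ := hx
  change ‖x‖ ≤ 1
  have h0 : (q.map (algebraMap ℤ (AlgebraicClosure K))).eval x = 0 := by
    rw [eval_map]
    exact hqx
  refine norm_le_one_of_norm_eval_le_one (hq.map (algebraMap ℤ (AlgebraicClosure K)))
    (fun i => ?_) (fun hd => ?_) (by rw [h0]; simp)
  · rw [coeff_map]
    exact IsUltrametricDist.norm_intCast_le_one _ _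
  · rw [eq_one_of_monic_natDegree_zero (hq.map _) hd] at h0
    simp at h0

/-- The prime of the ring of integers of a number field `E` cut out by an absolute value of the
algebraic closure. -/
def primeBelow (hw : IsNonarchimedean w) (E : IntermediateField K (AlgebraicClosure K)) :
    Ideal (𝓞 E) where
  carrier := {x | w ((x : E) : AlgebraicClosure K) < 1}
  add_mem' {x y} hx hy := by
    have hx : w ((x : E) : AlgebraicClosure K) < 1 := hx
    have hy : w ((y : E) : AlgebraicClosure K) < 1 := hy
    refine lt_of_le_of_lt ?_ (max_lt hx hy)
    simpa using hw ((x : E) : AlgebraicClosure K) ((y : E) : AlgebraicClosure K)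
  zero_mem' := by simp
  smul_mem' c x hx := by
    have hc : w ((c : E) : AlgebraicClosure K) ≤ 1 :=
      apply_le_one_of_isIntegral hw (c.isIntegral_coe.map (E.val.restrictScalars ℤ))
    have hx : w ((x : E) : AlgebraicClosure K) < 1 := hx
    simpa using mul_lt_one_of_nonneg_of_lt_one_right hc (w.nonneg _) hx

theorem mem_primeBelow {hw : IsNonarchimedean w} {E : IntermediateField K (AlgebraicClosure K)}
    {x : 𝓞 E} : x ∈ primeBelow hw E ↔ w ((x : E) : AlgebraicClosure K) < 1 := Iff.rfl

theorem isPrime_primeBelow (hw : IsNonarchimedean w)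
    (E : IntermediateField K (AlgebraicClosure K)) : (primeBelow hw E).IsPrime := by
  refine ⟨fun h => ?_, fun {x y} hxy => ?_⟩
  · have := (Ideal.eq_top_iff_one _).1 h
    rw [mem_primeBelow] at this
    simp at this
  · by_contra! h
    simp only [mem_primeBelow, not_lt, map_mul, MulMemClass.coe_mul] at h hxy
    exact absurd hxy (not_lt.2 (one_le_mul_of_one_le_of_one_le h.1 h.2))

theorem liesOver_primeBelow (hw : IsNonarchimedean w)
    (hv : w.LiesOver (NumberField.HeightOneSpectrum.adicAbv K v))
    (E : IntermediateField K (AlgebraicClosure K)) : (primeBelow hw E).LiesOver v.asIdeal := by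
  refine ⟨Ideal.ext fun x => ?_⟩
  rw [Ideal.under_def, Ideal.mem_comap, mem_primeBelow]
  have h1 : (((algebraMap (𝓞 K) (𝓞 E) x : 𝓞 E) : E) : AlgebraicClosure K) =
      algebraMap K (AlgebraicClosure K) (x : K) := rfl
  rw [h1, apply_algebraMap_of_liesOver hv]
  exact (v.adicAbv_coe_lt_one_iff (HeightOneSpectrum.one_lt_absNorm_nnreal v) x).symm

/-- In a Galois extension `E` of `K` with ramification index `e` above `v`, the `e`-th power of
every absolute value on `E` is an integral power of that of a uniformizer `π` of `v`. All primes of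
`E` above `v` have the same `e`, so it does not matter which of them `w` cuts out. -/
theorem exists_zpow_eq_of_mem (hw : IsNonarchimedean w)
    (hv : w.LiesOver (NumberField.HeightOneSpectrum.adicAbv K v)) {π : K}
    (hπ : v.valuation K π = WithZero.exp (-1 : ℤ))
    (E : IntermediateField K (AlgebraicClosure K)) [FiniteDimensional K E] [IsGalois K E]
    (P : Ideal (𝓞 E)) (hP : P.IsPrime) (hPv : P.LiesOver v.asIdeal) {x : E} (hx : x ≠ 0) :
    ∃ u : ℤ, w (x : AlgebraicClosure K) ^ P.ramificationIdx (𝓞 K) =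
      w (algebraMap K (AlgebraicClosure K) π) ^ u := by
  have : NumberField E := NumberField.of_module_finite K E
  have := isPrime_primeBelow hw E
  have := liesOver_primeBelow hw hv E
  set Q := primeBelow hw E with hQ
  have hQ0 : Q ≠ ⊥ := Ideal.ne_bot_of_liesOver_of_ne_bot v.ne_bot Q
  let V : HeightOneSpectrum (𝓞 E) := ⟨Q, inferInstance, hQ0⟩
  have : V.asIdeal.LiesOver v.asIdeal := liesOver_primeBelow hw hv E
  have he : P.ramificationIdx (𝓞 K) = v.asIdeal.ramificationIdx' V.asIdeal := by
    rw [Ideal.ramificationIdx_eq_of_isGaloisGroup v.asIdeal P Q Gal(E/K),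
      Ideal.ramificationIdx'_eq_ramificationIdx v.asIdeal Q v.ne_bot]
  have hle : ∀ y : E, V.valuation E y ≤ 1 → w (y : AlgebraicClosure K) ≤ 1 := by
    intro y hy
    obtain ⟨n, d, hnd⟩ := V.exists_primeCompl_mul_eq_of_integer y hy
    have hd : w (((d : 𝓞 E) : E) : AlgebraicClosure K) = 1 := by
      refine le_antisymm (apply_le_one_of_isIntegral hw
        ((d : 𝓞 E).isIntegral_coe.map (E.val.restrictScalars ℤ))) (not_lt.1 fun h => d.2 h)
    have hn : w ((n : E) : AlgebraicClosure K) ≤ 1 :=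
      apply_le_one_of_isIntegral hw (n.isIntegral_coe.map (E.val.restrictScalars ℤ))
    have h1 : w ((y * (d : 𝓞 E) : E) : AlgebraicClosure K) = w ((n : E) : AlgebraicClosure K) :=
      congrArg (fun z : E => w (z : AlgebraicClosure K)) hnd
    rw [MulMemClass.coe_mul, map_mul, hd, mul_one] at h1
    rwa [h1]
  have hone : ∀ y : E, V.valuation E y = 1 → w (y : AlgebraicClosure K) = 1 := by
    intro y hy
    refine le_antisymm (hle y hy.le) ?_
    have hy0 : y ≠ 0 := by
      rintro rfl
      simp at hy
    have h1 := hle y⁻¹ (by rw [map_inv₀, hy, inv_one])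
    rw [show ((y⁻¹ : E) : AlgebraicClosure K) = (y : AlgebraicClosure K)⁻¹ from rfl,
      map_inv₀] at h1
    exact (inv_le_one₀ (w.pos (by simpa using hy0))).1 h1
  have hVπ := HeightOneSpectrum.valuation_liesOver E v V π
  rw [hπ, ← he] at hVπ
  set e := P.ramificationIdx (𝓞 K)
  have hVx : V.valuation E x ≠ 0 := (Valuation.ne_zero_iff _).2 hx
  refine ⟨-WithZero.log (V.valuation E x), ?_⟩
  have h1 := hone (x ^ e * (algebraMap K E π) ^ WithZero.log (V.valuation E x)) (by
    rw [map_mul, map_pow, map_zpow₀, ← hVπ]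
    nth_rewrite 1 [← WithZero.exp_log hVx]
    rw [← WithZero.exp_nsmul, ← WithZero.exp_nsmul, ← WithZero.exp_zsmul, ← WithZero.exp_add,
      ← WithZero.exp_zero]
    congr 1
    simp
    ring)
  have h2 : w ((x ^ e * (algebraMap K E π) ^ WithZero.log (V.valuation E x) : E) :
      AlgebraicClosure K) = w (x : AlgebraicClosure K) ^ e *
        w (algebraMap K (AlgebraicClosure K) π) ^ WithZero.log (V.valuation E x) := by
    have h3 : ((x ^ e * (algebraMap K E π) ^ WithZero.log (V.valuation E x) : E) :
        AlgebraicClosure K) = (x : AlgebraicClosure K) ^ e *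
          algebraMap K (AlgebraicClosure K) π ^ WithZero.log (V.valuation E x) := by
      rw [MulMemClass.coe_mul, SubmonoidClass.coe_pow]
      congr 1
    rw [h3, map_mul, map_pow, map_zpow₀]
  rw [h2] at h1
  rw [zpow_neg]
  exact eq_inv_of_mul_eq_one_left h1

end Places

/-! ### Affine conjugation -/

section AffineConjugation

variable {F : Type*} [Field F] {α β : F}

theorem eval_affineConj (hα : α ≠ 0) (f : F[X]) (z : F) :
    (affineConj α β f).eval (α * z + β) = α * f.eval z + β := by
  simp [affineConj, eval_comp, hα]

theorem iterate_eval_affineConj (hα : α ≠ 0) (f : F[X]) (n : ℕ) (z : F) :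
    (fun z => (affineConj α β f).eval z)^[n] (α * z + β) =
      α * (fun z => f.eval z)^[n] z + β := by
  induction n with
  | zero => rfl
  | succ n ih =>
    rw [Function.iterate_succ_apply', Function.iterate_succ_apply', ih, eval_affineConj hα]

theorem natDegree_affineConj (hα : α ≠ 0) (f : F[X]) :
    (affineConj α β f).natDegree = f.natDegree := by
  rw [affineConj, natDegree_comp, natDegree_comp, natDegree_linear hα,
    natDegree_C_mul (inv_ne_zero hα), natDegree_X_sub_C]
  simp

theorem derivative_affineConj_eval (hα : α ≠ 0) (f : F[X]) (z : F) :
    (derivative (affineConj α β f)).eval (α * z + β) = (derivative f).eval z := by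
  simp [affineConj, derivative_comp, hα]

theorem exists_eq_of_mem_postcriticalSet_affineConj (hα : α ≠ 0) {f : F[X]} {x : F}
    (hx : x ∈ postcriticalSet (affineConj α β f)) : ∃ y ∈ postcriticalSet f, x = α * y + β := by
  obtain ⟨n, γ, hγ, rfl⟩ := hx
  obtain ⟨z, rfl⟩ : ∃ z, γ = α * z + β := ⟨α⁻¹ * (γ - β), by field_simp; ring⟩
  rw [derivative_affineConj_eval hα] at hγ
  exact ⟨_, ⟨n, z, hγ, rfl⟩, iterate_eval_affineConj hα f n z⟩

end AffineConjugation

/-! ### Fields generated by preimages -/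

section PreimageFields

variable {K : Type*} [Field K]

theorem preimages_eq_rootSet {f : K[X]} (hd : f.natDegree ≠ 0) (a : K) (n : ℕ) :
    preimages f a n = (f.comp^[n] X - C a).rootSet (AlgebraicClosure K) := by
  have hdeg : (f.comp^[n] X).natDegree = f.natDegree ^ n := by
    induction n with
    | zero => simp
    | succ n ih => rw [Function.iterate_succ_apply', natDegree_comp, ih, pow_succ']
  have hne : f.comp^[n] X - C a ≠ 0 := fun h => by
    have h1 := natDegree_sub_C (p := f.comp^[n] X) (a := a)
    rw [h, natDegree_zero, hdeg] at h1
    exact pow_ne_zero _ hd h1.symm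
  ext x
  rw [mem_rootSet, and_iff_right hne, map_sub, aeval_C, sub_eq_zero, aeval_def,
    iterate_comp_eval₂, eval₂_X]
  simp only [preimages, Set.mem_ofPred_eq, eval_map]

theorem isSplittingField_preimageField {f : K[X]} (hd : f.natDegree ≠ 0) (a : K) (n : ℕ) :
    IsSplittingField K (preimageField f a n) (f.comp^[n] X - C a) := by
  rw [preimageField, preimages_eq_rootSet hd]
  exact IntermediateField.adjoin_rootSet_isSplittingField (IsAlgClosed.splits _)

theorem finiteDimensional_preimageField {f : K[X]} (hd : f.natDegree ≠ 0) (a : K) (n : ℕ) :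
    FiniteDimensional K (preimageField f a n) :=
  have := isSplittingField_preimageField hd a n
  IsSplittingField.finiteDimensional (preimageField f a n) (f.comp^[n] X - C a)

theorem isGalois_preimageField [CharZero K] {f : K[X]} (hd : f.natDegree ≠ 0) (a : K) (n : ℕ) :
    IsGalois K (preimageField f a n) :=
  have := isSplittingField_preimageField hd a n
  have := Normal.of_isSplittingField (F := K) (E := preimageField f a n) (f.comp^[n] X - C a)
  ⟨⟩

theorem eval_mem_intermediateField {f : K[X]} {E : IntermediateField K (AlgebraicClosure K)}
    {x : AlgebraicClosure K} (hx : x ∈ E) (n : ℕ) :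
    (fun z => (f.map (algebraMap K (AlgebraicClosure K))).eval z)^[n] x ∈ E := by
  induction n with
  | zero => exact hx
  | succ n ih =>
    rw [Function.iterate_succ_apply', eval_map_algebraMap]
    exact IntermediateField.aeval_coe E (⟨_, ih⟩ : E) f ▸ (aeval (⟨_, ih⟩ : E) f).2

/-- A preimage of level `l ≤ n` is the image under an iterate of `f` of one of level `n`. -/
theorem mem_preimageField {f : K[X]} (hd : f.natDegree ≠ 0) {a : K} {l n : ℕ} (hln : l ≤ n)
    {x : AlgebraicClosure K} (hx : x ∈ preimages f a l) : x ∈ preimageField f a n := by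
  obtain ⟨y, rfl⟩ := exists_iterate_eval_eq
    (g := f.map (algebraMap K (AlgebraicClosure K))) (by rwa [natDegree_map]) (n - l) x
  refine eval_mem_intermediateField (IntermediateField.subset_adjoin K _ ?_) (n - l)
  change _ = _
  rw [← Nat.add_sub_of_le hln, Function.iterate_add_apply]
  exact hx

end PreimageFields

theorem le_padicValNat_of_mul_eq {p : ℕ} (hp : p.Prime) {l u : ℤ} {h e Q h' N : ℕ} (hl : l ≠ 0)
    (hh : h ≠ 0) (he : e ≠ 0) (hQ : p ^ N ∣ Q) (heq : l * h * e = u * Q * h') :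
    N ≤ padicValNat p (l.natAbs * h) + padicValNat p e := by
  have := Fact.mk hp
  have hne : l.natAbs * h ≠ 0 := mul_ne_zero (Int.natAbs_ne_zero.2 hl) hh
  rw [← padicValNat.mul hne he, ← padicValNat_dvd_iff_le (mul_ne_zero hne he)]
  have h1 : ((p ^ N : ℕ) : ℤ) ∣ l * h * e := by
    rw [heq]
    exact ((Int.natCast_dvd_natCast.2 hQ).mul_left u).mul_right _
  simpa [Int.natAbs_mul] using Int.natCast_dvd.1 h1

/-! ### Infinite wild ramification -/

section Main

variable {K : Type*} [Field K] [NumberField K]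

theorem exists_zpow_eq_adicAbv {v : HeightOneSpectrum (𝓞 K)} {π : K}
    (hπ : v.valuation K π = WithZero.exp (-1 : ℤ)) {x : K} (hx : x ≠ 0) :
    ∃ l : ℤ, NumberField.HeightOneSpectrum.adicAbv K v x =
      NumberField.HeightOneSpectrum.adicAbv K v π ^ l := by
  have hvx : v.valuation K x ≠ 0 := (Valuation.ne_zero_iff _).2 hx
  refine ⟨-WithZero.log (v.valuation K x), ?_⟩
  rw [← map_zpow₀, NumberField.HeightOneSpectrum.adicAbv_def,
    NumberField.HeightOneSpectrum.adicAbv_def]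
  congr 2
  rw [map_zpow₀, hπ, ← WithZero.exp_zsmul]
  conv_lhs => rw [← WithZero.exp_log hvx]
  simp

/-- The distances of `hasWildDistances_of_infinite` lie, up to a bounded exponent, in the value group
of `K_n`, which the ramification index relates to the powers of `w(π)`. -/
theorem infinitelyWildlyRamified_of_infinite {p : ℕ} (hp : p.Prime) {v : HeightOneSpectrum (𝓞 K)}
    (hv : (p : 𝓞 K) ∈ v.asIdeal) {f : K[X]} (hdeg : 2 ≤ f.natDegree) (hpf : p ∣ f.natDegree)
    (hred : PotentialGoodReduction v f) (hpc : PostcriticallyBounded v f) {a : K}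
    (hinf : (backwardOrbit f a).Infinite) :
    InfinitelyWildlyRamified p v (preimageField f a) := by
  obtain ⟨w, hwv, hw⟩ := exists_absoluteValue_liesOver v
  obtain ⟨α, β, hα, hgood⟩ := hred
  obtain ⟨hgm, hgi⟩ := hgood w hwv
  obtain ⟨B, hB⟩ := hpc w hwv
  set f' := f.map (algebraMap K (AlgebraicClosure K)) with hf'
  set g := affineConj α β f' with hg
  have hgd : g.natDegree = f.natDegree := by
    rw [hg, natDegree_affineConj hα, hf', natDegree_map]
  have hpw : w (p : AlgebraicClosure K) < 1 := by
    have h1 := (v.adicAbv_coe_lt_one_iff (K := K)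
      (NumberField.HeightOneSpectrum.one_lt_absNorm_nnreal v) (p : 𝓞 K)).2 hv
    rw [map_natCast] at h1
    have h2 := apply_algebraMap_of_liesOver hwv (p : K)
    rw [map_natCast] at h2
    rw [h2]
    exact h1
  have hwild : ∃ s t : AlgebraicClosure K, t ≠ 0 ∧ w t ≠ 1 ∧
      ∀ n : ℕ, ∃ (L Q : ℕ) (x y : AlgebraicClosure K),
        (fun z => g.eval z)^[L] x = α * algebraMap K (AlgebraicClosure K) a + β ∧
          ((fun z => g.eval z)^[L] y = α * algebraMap K (AlgebraicClosure K) a + β ∨ y = s) ∧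
            p ^ n ∣ Q ∧ w (x - y) ^ Q = w t := by
    let : NormedField (AlgebraicClosure K) := w.toNormedField
    have : IsUltrametricDist (AlgebraicClosure K) :=
      IsUltrametricDist.isUltrametricDist_of_isNonarchimedean_norm hw
    have hgi' : g ∈ integralPoly (AlgebraicClosure K) := hgi
    have hds : IsSmall (derivative g) := by
      refine isSmall_derivative hgm hgi' (hgd ▸ hdeg) ?_ ⟨w α * B + w β, fun x hx => ?_⟩
      · obtain ⟨c, hc⟩ := hpf
        rw [hgd, hc, Nat.cast_mul, norm_mul]
        exact mul_lt_one_of_nonneg_of_lt_one_left (norm_nonneg _) hpw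
          (IsUltrametricDist.norm_natCast_le_one _ c)
      · obtain ⟨y, hy, rfl⟩ := exists_eq_of_mem_postcriticalSet_affineConj hα hx
        refine (w.add_le _ _).trans ?_
        rw [map_mul]
        gcongr
        exact hB y hy
    have hd0 : derivative g ≠ 0 := fun h => by
      have := natDegree_derivative g
      rw [h, natDegree_zero] at this
      omega
    refine hasWildDistances_of_infinite hp hpw hgm hgi' (hgd ▸ hdeg) (hgd ▸ hpf) hd0 hds ?_
    refine Set.Infinite.mono ?_ (hinf.image (f := fun z => α * z + β) fun x _ y _ hxy => ?_)
    · rintro _ ⟨z, hz, rfl⟩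
      obtain ⟨n, hn⟩ := Set.mem_iUnion.1 hz
      refine ⟨n, ?_⟩
      have hn : (fun z => f'.eval z)^[n] z = algebraMap K (AlgebraicClosure K) a := hn
      rw [hg, iterate_eval_affineConj hα, hn]
    · exact mul_left_cancel₀ hα (add_right_cancel hxy)
  obtain ⟨s, t, ht0, ht1, hwild⟩ := hwild
  intro P hP
  -- A uniformizer `π` of `v`.
  obtain ⟨π, hπ⟩ := v.intValuation_exists_uniformizer
  have hπv : v.valuation K (π : K) = WithZero.exp (-1 : ℤ) := by
    rw [← hπ]
    exact v.valuation_of_algebraMap π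
  set c := w (algebraMap K (AlgebraicClosure K) (π : K)) with hc
  have hcv := apply_algebraMap_of_liesOver hwv (π : K)
  have hπ0 : (π : K) ≠ 0 := by
    rintro h
    rw [h, map_zero] at hπv
    exact WithZero.exp_ne_zero hπv.symm
  have hc0 : 0 < c := w.pos (by simpa using hπ0)
  have hc1 : c < 1 := by
    rw [hc, hcv]
    refine (v.adicAbv_coe_lt_one_iff (NumberField.HeightOneSpectrum.one_lt_absNorm_nnreal v) π).2 ?_
    rw [← v.valuation_lt_one_iff_mem (K := K), v.valuation_of_algebraMap, hπ,
      ← WithZero.exp_zero, WithZero.exp_lt_exp]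
    norm_num
  -- As `t` is algebraic over `K`, a power of `w t` is some `c ^ l`, with `l ≠ 0` because `w t ≠ 1`.
  obtain ⟨x₀, hx₀, htx₀⟩ := exists_pow_factorial_eq (k := K) w hw ht0
    (Algebra.IsIntegral.isIntegral t) le_rfl
  set h' := (minpoly K t).natDegree.factorial with hh'
  obtain ⟨l, hl⟩ := exists_zpow_eq_adicAbv hπv hx₀
  rw [apply_algebraMap_of_liesOver hwv, hl, ← hcv, ← hc] at htx₀
  have hl0 : l ≠ 0 := by
    rintro rfl
    rw [zpow_zero] at htx₀
    exact ht1 ((pow_eq_one_iff_of_nonneg (w.nonneg t) (Nat.factorial_ne_zero _)).1 htx₀)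
  -- The finite extension of `K` needed to pass between the coordinates of `f` and `g`.
  let M := IntermediateField.adjoin K ({α, β, s} : Set (AlgebraicClosure K))
  have hMfin : FiniteDimensional K M := IntermediateField.finiteDimensional_adjoin
    fun x _ => Algebra.IsIntegral.isIntegral x
  have hαM : α ∈ M := IntermediateField.subset_adjoin K _ (by simp)
  have hβM : β ∈ M := IntermediateField.subset_adjoin K _ (by simp)
  have hsM : s ∈ M := IntermediateField.subset_adjoin K _ (by simp)
  set r := (Module.finrank K M).factorial with hr
  refine tendsto_atTop_atTop.2 fun b => ?_
  -- The valuation of `l * r` is the loss caused by the exponents `l` and `r`.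
  obtain ⟨L, Q, x, y, hx, hy, hQ, hxy⟩ := hwild (b + padicValNat p (l.natAbs * r))
  refine ⟨L, fun n hn => ?_⟩
  have hd' : f.natDegree ≠ 0 := by omega
  have hEfin := finiteDimensional_preimageField hd' a n
  have hEgal := isGalois_preimageField hd' a n
  set E := preimageField f a n with hE
  have hmem : ∀ x, (fun z => g.eval z)^[L] x = α * algebraMap K (AlgebraicClosure K) a + β →
      x ∈ E ⊔ M := by
    intro x hx
    obtain ⟨z, rfl⟩ : ∃ z, x = α * z + β := ⟨α⁻¹ * (x - β), by field_simp; ring⟩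
    rw [hg, iterate_eval_affineConj hα] at hx
    have hz : z ∈ E := mem_preimageField hd' hn (mul_left_cancel₀ hα (add_right_cancel hx))
    exact add_mem (mul_mem ((le_sup_right : M ≤ E ⊔ M) hαM) ((le_sup_left : E ≤ E ⊔ M) hz))
      ((le_sup_right : M ≤ E ⊔ M) hβM)
  have hxyM : x - y ∈ E ⊔ M := sub_mem (hmem x hx) (by
    rcases hy with hy | rfl
    · exact hmem y hy
    · exact (le_sup_right : M ≤ E ⊔ M) hsM)
  have hxy0 : x - y ≠ 0 := by
    intro h
    rw [h, map_zero] at hxy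
    rcases Nat.eq_zero_or_pos Q with rfl | hQ0
    · exact ht1 (by rw [← hxy, pow_zero])
    · rw [zero_pow hQ0.ne'] at hxy
      exact (w.pos ht0).ne hxy
  obtain ⟨x₁, hx₁, hxx₁⟩ := exists_pow_factorial_eq_of_mem_sup w hw E M hxy0 hxyM
  obtain ⟨u, hu⟩ := exists_zpow_eq_of_mem hw hwv hπv E (P n) (hP.isPrime n) (hP.liesOver n) hx₁
  set e := (P n).ramificationIdx (𝓞 K) with he
  have he0 : e ≠ 0 := by
    have := NumberField.of_module_finite K E
    have := hP.isPrime n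
    exact (Ideal.ramificationIdx_pos (P n) (𝓞 K)).ne'
  have hexp : c ^ (l * r * e) = c ^ (u * Q * h') := by
    calc c ^ (l * r * e) = ((w t ^ h') ^ r) ^ e := by
          rw [htx₀, zpow_mul, zpow_mul, zpow_natCast, zpow_natCast]
      _ = (((w (x - y) ^ r) ^ e) ^ Q) ^ h' := by
          rw [← hxy]
          simp only [← pow_mul]
          congr 1
          ring
      _ = c ^ (u * Q * h') := by
          rw [hr, hxx₁, hu, zpow_mul, zpow_mul, zpow_natCast, zpow_natCast]
  have hfin := le_padicValNat_of_mul_eq (h := r) hp hl0 (Nat.factorial_ne_zero _) he0 hQ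
    (zpow_right_injective₀ hc0 hc1.ne hexp)
  omega

theorem PostcriticallyFinite.postcriticallyBounded {f : K[X]} (hf : PostcriticallyFinite f)
    (v : HeightOneSpectrum (𝓞 K)) : PostcriticallyBounded v f := fun w _ => by
  obtain ⟨B, hB⟩ := (hf.image w).bddAbove
  exact ⟨B, fun x hx => hB ⟨x, hx, rfl⟩⟩

end Main

end ArborealWild

theorem theorem1 {K : Type*} [Field K] [NumberField K]
    (p : ℕ) (hp : p.Prime) (v : HeightOneSpectrum (𝓞 K)) (hv : (p : 𝓞 K) ∈ v.asIdeal)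
    (f : K[X]) (hdeg : 2 ≤ f.natDegree) (hpf : p ∣ f.natDegree)
    (hred : ArborealWild.PotentialGoodReduction v f) :
    (ArborealWild.PostcriticallyBounded v f →
      ∀ a : K, (ArborealWild.backwardOrbit f a).Infinite →
        ArborealWild.AvoidsPostcriticalSet v f a →
        ArborealWild.InfinitelyWildlyRamified p v (ArborealWild.preimageField f a)) ∧
    (ArborealWild.PostcriticallyFinite f →
      ∀ a : K, (ArborealWild.backwardOrbit f a).Infinite →
        ArborealWild.InfinitelyWildlyRamified p v (ArborealWild.preimageField f a)) :=
  ⟨fun hpc _ hinf _ =>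
      ArborealWild.infinitelyWildlyRamified_of_infinite hp hv hdeg hpf hred hpc hinf,
    fun hfin _ hinf => ArborealWild.infinitelyWildlyRamified_of_infinite hp hv hdeg hpf hred
      (hfin.postcriticallyBounded v) hinf⟩
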